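/- Definitions. Let $A$ be an additive group and $\varepsilon\in\mathbb R$. A random element $X$ of $A$ is *$\varepsilon$-balanced* if $\mathbb P[X\in g+H]\le 1-\varepsilon$ for every proper subgroup $H<A$ and every $g\in A$. For real numbers $w,h,\varepsilon$, an $n\times m$ random matrix $M$ with entries in a ring $R$ is *$(w,h,\varepsilon)$-balanced* if there are a partition $\mathcal P$ of the row set $[n]=\{1,\dots,n\}$ into nonempty sets of size at most $h$ and a partition $\mathcal Q$ of the column set $[m]$ into nonempty sets of size at most $w$ such that, for all $P\in\mathcal P$ and $Q\in\mathcal Q$, the submatrix $M_{P,Q}$ with rows $P$ and columns $Q$ is $\varepsilon$-balanced as a random element of the additive group of $\#P\times\#Q$ matrices over $R$, and the random matrices $M_{P,Q}$ $(P\in\mathcal P,\ Q\in\mathcal Q)$ are jointly independent. The cokernel $\operatorname{coker}(M)$ of an $n\times m$ matrix over $R$ is the quotient of $R^n$ by the span of the columns of $M$, and $\#\operatorname{Sur}(X,G)$ is the number of surjective group homomorphisms $X\to G$. Theorem. Let $u\ge 0$ be an integer, let $G$ be a finite abelian group, and let $a\ge 0$ be an integer divisible by the exponent of $G$ ($a=0$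 is allowed, and then $\mathbb Z/a\mathbb Z=\mathbb Z$). Let $(w_n)_n,(h_n)_n,(\varepsilon_n)_n$ be sequences of real numbers, and let $0\le\alpha_1,\alpha_2,\beta<1$ be real numbers with $$2\alpha_1+\alpha_2<1-2\beta,$$ such that $w_n=O(n^{\alpha_1})$, $h_n=O(n^{\alpha_2})$ and $\varepsilon_n=\Omega(n^{-\beta})$; that is, there are real constants $A,A'$ and $B>0$ with $w_n\le An^{\alpha_1}$, $h_n\le A'n^{\alpha_2}$ and $\varepsilon_n\ge Bn^{-\beta}$ for all sufficiently large $n$. For each integer $n\ge 0$ let $M_n$ be a $(w_n,h_n,\varepsilon_n)$-balanced $n\times(n+u)$ random matrix with entries in $\mathbb Z/a\mathbb Z$. Then $\#\operatorname{Sur}(\operatorname{coker}(M_n),G)$ has finite expectation for every $n$, and $$\lim_{n\to\infty}\mathbb E\bigl[\#\operatorname{Sur}(\operatorname{coker}(M_n),G)\bigr]=|G|^{-u}.$$ -/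

import Mathlib

open MeasureTheory ProbabilityTheory Filter Topology

open scoped Pointwise

/-- A random element `X` of an additive group `A` is `ε`-balanced if it lies in any given coset of
any given proper subgroup with probability at most `1 - ε`. -/
def IsEpsBalanced {Ω : Type*} [MeasurableSpace Ω] (μ : Measure Ω) {A : Type*} [AddGroup A]
    (X : Ω → A) (ε : ℝ) : Prop :=
  ∀ H : AddSubgroup A, H ≠ ⊤ → ∀ g : A, μ.real {ω | X ω ∈ g +ᵥ (H : Set A)} ≤ 1 - ε

/-- The submatrix of `A` with row set `S` and column set `T`, indexed by `S` and `T` themselves. -/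
def matrixBlock {m n : ℕ} {R : Type*} (A : Matrix (Fin m) (Fin n) R) (S : Finset (Fin m))
    (T : Finset (Fin n)) : Matrix S T R :=
  A.submatrix (fun i : S => (i : Fin m)) (fun j : T => (j : Fin n))

/-- An `m × n` random matrix `M` over `R` is `(w, h, ε)`-balanced if there are a partition `P` of
the rows into nonempty sets of size at most `h` and a partition `Q` of the columns into nonempty
sets of size at most `w` such that every block is `ε`-balanced in the additive group of matrices of
its shape, and all the blocks are (jointly) independent. -/
def IsBalancedMatrix {Ω : Type*} [MeasurableSpace Ω] (μ : Measure Ω) {m n : ℕ} {R : Type*} [Ring R]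
    [MeasurableSpace R] (M : Ω → Matrix (Fin m) (Fin n) R) (w h ε : ℝ) : Prop :=
  ∃ (P : Finpartition (Finset.univ : Finset (Fin m)))
    (Q : Finpartition (Finset.univ : Finset (Fin n))),
    (∀ S ∈ P.parts, (S.card : ℝ) ≤ h) ∧
    (∀ T ∈ Q.parts, (T.card : ℝ) ≤ w) ∧
    (∀ S ∈ P.parts, ∀ T ∈ Q.parts, IsEpsBalanced μ (fun ω => matrixBlock (M ω) S T) ε) ∧
    iIndepFun (β := fun b : P.parts × Q.parts =>
        Matrix (b.1 : Finset (Fin m)) (b.2 : Finset (Fin n)) R)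
      (m := fun _ => MeasurableSpace.pi)
      (fun b ω => matrixBlock (M ω) (b.1 : Finset (Fin m)) (b.2 : Finset (Fin n))) μ

/-- The cokernel of an `m × n` matrix `A` over `R`: the quotient of `R ^ m` by the span of the
columns of `A`. -/
abbrev matrixCoker {m n : ℕ} {R : Type*} [CommRing R] (A : Matrix (Fin m) (Fin n) R) : Type _ :=
  (Fin m → R) ⧸ LinearMap.range A.mulVecLin

/-- The number of surjective group homomorphisms from `X` to `G`. -/
noncomputable def numSur (X G : Type*) [AddCommGroup X] [AddCommGroup G] : ℕ :=
  Nat.card {f : X →+ G // Function.Surjective f}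

/-- Only finitely many homomorphisms go from the cokernel of a matrix over `ℤ/aℤ` to a finite
group, so that `numSur` is a genuine count for such groups. -/
theorem finite_coker_addMonoidHom {m n a : ℕ} (A : Matrix (Fin m) (Fin n) (ZMod a))
    (G : Type*) [AddCommGroup G] [Finite G] : Finite (matrixCoker A →+ G) := by
  let b : (matrixCoker A →+ G) → (Fin m → G) := fun f i =>
    f (Submodule.Quotient.mk (Pi.single i 1))
  refine Finite.of_injective b ?_
  intro f g hfg
  ext x
  obtain ⟨v, rfl⟩ := Submodule.Quotient.mk_surjective _ x
  have key : ∀ (i : Fin m) (c : ZMod a),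
      f (Submodule.Quotient.mk (Pi.single i c)) = g (Submodule.Quotient.mk (Pi.single i c)) := by
    intro i c
    obtain ⟨k, rfl⟩ := ZMod.intCast_surjective c
    have h1 : (Pi.single i (k : ZMod a) : Fin m → ZMod a) = k • Pi.single i 1 := by
      rw [← Pi.single_smul]; simp
    have h2 : (Submodule.Quotient.mk (k • Pi.single i 1) : matrixCoker A)
        = k • Submodule.Quotient.mk (Pi.single i 1) := rfl
    rw [h1, h2, map_zsmul, map_zsmul]
    exact congrArg (fun y => k • y) (congrFun hfg i)
  have hv : v = ∑ i, Pi.single i (v i) := (Finset.univ_sum_single v).symm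
  have h3 : (Submodule.Quotient.mk v : matrixCoker A)
      = ∑ i, Submodule.Quotient.mk (Pi.single i (v i)) := by
    conv_lhs => rw [hv]
    exact map_sum (Submodule.mkQ _) _ _
  rw [h3, map_sum, map_sum]
  exact Finset.sum_congr rfl fun i _ => key i (v i)

/-! A surjection from the cokernel to G is a tuple f of n elements spanning G with fM = 0
(`numSur_matrixCoker`), so the moment is the sum of P(fM = 0) over spanning f. If every fM were
uniform on G^(n+u), then about |G|^n tuples would contribute |G|^(-(n+u)) each, giving |G|^(-u). The
proof fixes a threshold k and compares with this heuristic.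

Call f a code if it still spans G after any fewer than k row blocks are deleted. Over a column block
T, the corresponding part of fM is a sum of independent contributions of the row blocks. A
nontrivial character of G^T is nonconstant on at least k of them, and each such contribution shrinks
the Fourier coefficient by exp(-cε/2). Hence fM is equidistributed over T up to exp(-cεk/2), and
multiplying over T gives relative error at most exp(D) - 1, where D = (n+u) |G|^w exp(-cεk/2).

If f is not a code, `exists_robust_span` supplies a proper submodule H and at most k|G| exceptional
row blocks, outside of which f lies in H and spans it robustly. For spanning f some exceptional
block leaves H, so each column block costs an extra factor 1 - ε beyond equidistribution in H. There
are at least (n+u)/w column blocks, so P(fM = 0) is at most |H|^(-(n+u)) exp(-ε(n+u)/w) exp(D). The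
number of such f exceeds |H|^n only by (n+1)^(k|G|) |G|^(k|G|h).

With k about n^κ, D tends to 0 if κ > α₁ + β, and the saving beats the count if κ + α₂ < 1 - α₁ - β.
Such a κ exists exactly when 2α₁ + α₂ < 1 - 2β. -/

/-! ### Fourier coefficients and equidistribution in a finite abelian group. -/

/-- There are finitely many such roots, all on the unit circle, where only 1 has real part 1. The
gap depends on e alone, so in the application it is uniform in n. -/
theorem exists_rootOfUnity_gap {e : ℕ} (he : 0 < e) :
    ∃ c : ℝ, 0 < c ∧ ∀ z : ℂ, z ^ e = 1 → z ≠ 1 → z.re ≤ 1 - c := by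
  classical
  set s : Finset ℂ := (Polynomial.nthRootsFinset e (1 : ℂ)).erase 1 with hs
  have hmem : ∀ z : ℂ, z ∈ s ↔ z ≠ 1 ∧ z ^ e = 1 := by
    intro z
    rw [hs, Finset.mem_erase, Polynomial.mem_nthRootsFinset he]
  have hpos : ∀ z ∈ s, 0 < 1 - z.re := by
    intro z hz
    obtain ⟨h1, h2⟩ := (hmem z).1 hz
    have hn : ‖z‖ = 1 := Complex.norm_eq_one_of_pow_eq_one h2 he.ne'
    have hle : z.re ≤ 1 := hn ▸ Complex.re_le_norm z
    rcases hle.lt_or_eq with h | h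
    · linarith
    · exfalso
      apply h1
      have h3 : z.re * z.re + z.im * z.im = 1 := by
        have := Complex.normSq_eq_norm_sq z
        rw [hn, Complex.normSq_apply] at this
        simpa using this
      have him : z.im = 0 := by
        rw [h] at h3
        exact mul_self_eq_zero.1 (by linarith)
      exact Complex.ext (by simpa using h) (by simpa using him)
  rcases s.eq_empty_or_nonempty with h | h
  · refine ⟨1, one_pos, fun z hz hz1 => ?_⟩
    have : z ∈ s := (hmem z).2 ⟨hz1, hz⟩
    simp [h] at this
  · obtain ⟨z₀, hz₀, hmin⟩ := s.exists_min_image (fun z => 1 - z.re) h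
    refine ⟨1 - z₀.re, hpos z₀ hz₀, fun z hz hz1 => ?_⟩
    have := hmin z ((hmem z).2 ⟨hz1, hz⟩)
    linarith

/-- Symmetrization: the squared norm is the mean of Re(v(x) conj v(y)) over two independent samples.
This root of unity loses at least c whenever v(x) ≠ v(y), which has probability at least ε. -/
theorem norm_sq_sum_rootsOfUnity_le {K : Type*} [Fintype K] {e : ℕ} (he : 0 < e) {c ε : ℝ}
    (hc0 : 0 < c) (hc : ∀ z : ℂ, z ^ e = 1 → z ≠ 1 → z.re ≤ 1 - c) (p : K → ℝ)
    (hp : ∀ x, 0 ≤ p x) (hp1 : ∑ x, p x = 1) (v : K → ℂ) (hv : ∀ x, v x ^ e = 1)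
    (hb : ∀ z, ∑ x with v x = z, p x ≤ 1 - ε) :
    ‖∑ x, (p x : ℂ) * v x‖ ^ 2 ≤ 1 - c * ε := by
  classical
  have hn : ∀ x, ‖v x‖ = 1 := fun x => Complex.norm_eq_one_of_pow_eq_one (hv x) he.ne'
  have key : ∀ x y, (v x * (starRingEnd ℂ) (v y)).re
      ≤ (1 - c) + c * (if v y = v x then 1 else 0) := by
    intro x y
    split_ifs with h
    · rw [h, Complex.mul_conj, Complex.normSq_eq_norm_sq, hn]; simp
    · have := hc (v x * (starRingEnd ℂ) (v y)) (by rw [mul_pow, ← map_pow, hv, hv]; simp) ?_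
      · linarith
      · intro h1
        apply h
        have h2 : v x * ((starRingEnd ℂ) (v y) * v y) = v y := by rw [← mul_assoc, h1, one_mul]
        rw [mul_comm ((starRingEnd ℂ) (v y)), Complex.mul_conj, Complex.normSq_eq_norm_sq, hn] at h2
        simpa using h2.symm
  have hsq : ‖∑ x, (p x : ℂ) * v x‖ ^ 2
      = ∑ x, ∑ y, p x * (p y * (v x * (starRingEnd ℂ) (v y)).re) := by
    have h1 : ((‖∑ x, (p x : ℂ) * v x‖ ^ 2 : ℝ) : ℂ)
        = (∑ x, (p x : ℂ) * v x) * (starRingEnd ℂ) (∑ x, (p x : ℂ) * v x) := by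
      rw [Complex.mul_conj, Complex.normSq_eq_norm_sq]
    have h2 := congrArg Complex.re h1
    rw [Complex.ofReal_re] at h2
    rw [h2, map_sum, Finset.sum_mul_sum, Complex.re_sum]
    refine Finset.sum_congr rfl fun x _ => ?_
    rw [Complex.re_sum]
    refine Finset.sum_congr rfl fun y _ => ?_
    rw [map_mul, Complex.conj_ofReal,
      show (p x : ℂ) * v x * ((p y : ℂ) * (starRingEnd ℂ) (v y))
        = ((p x : ℂ)) * ((p y : ℂ) * (v x * (starRingEnd ℂ) (v y))) by ring,
      Complex.re_ofReal_mul, Complex.re_ofReal_mul]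
  rw [hsq]
  calc ∑ x, ∑ y, p x * (p y * (v x * (starRingEnd ℂ) (v y)).re)
      ≤ ∑ x, ∑ y, p x * (p y * ((1 - c) + c * (if v y = v x then 1 else 0))) := by
        gcongr with x _ y _
        · exact hp x
        · exact hp y
        · exact key x y
    _ = ∑ x, p x * ((1 - c) + c * ∑ y with v y = v x, p y) := by
        refine Finset.sum_congr rfl fun x _ => ?_
        rw [← Finset.mul_sum]
        congr 1
        simp only [mul_add, Finset.sum_add_distrib, ← Finset.sum_mul, hp1, one_mul]
        rw [Finset.sum_filter, Finset.mul_sum]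
        congr 1
        refine Finset.sum_congr rfl fun y _ => ?_
        split_ifs <;> ring
    _ ≤ ∑ x, p x * ((1 - c) + c * (1 - ε)) := by
        gcongr with x _
        · exact hp x
        · exact hb (v x)
    _ = 1 - c * ε := by rw [← Finset.sum_mul, hp1]; ring

theorem norm_integral_addChar_le {Ω K : Type*} [MeasurableSpace Ω] {μ : Measure Ω}
    [IsProbabilityMeasure μ] [AddCommGroup K] [Finite K] [MeasurableSpace K]
    [DiscreteMeasurableSpace K] {e : ℕ} (he : 0 < e) (heK : ∀ x : K, e • x = 0) {c ε : ℝ}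
    (hc0 : 0 < c) (hc : ∀ z : ℂ, z ^ e = 1 → z ≠ 1 → z.re ≤ 1 - c) {X : Ω → K} (hX : Measurable X)
    (ψ : AddChar K ℂ) (hb : ∀ z, μ.real {ω | ψ (X ω) = z} ≤ 1 - ε) :
    ‖∫ ω, ψ (X ω) ∂μ‖ ≤ Real.exp (-(c / 2 * ε)) := by
  classical
  have := Fintype.ofFinite K
  have hfib : ∀ s : Finset K, ∑ x ∈ s, μ.real (X ⁻¹' {x}) = μ.real (X ⁻¹' s) := fun s =>
    sum_measureReal_preimage_singleton s fun y _ => hX (.of_discrete)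
  have hint : ∫ ω, ψ (X ω) ∂μ = ∑ x, (μ.real (X ⁻¹' {x}) : ℂ) * ψ x := by
    rw [← integral_map (φ := X) (f := fun x => ψ x) hX.aemeasurable
      (Measurable.of_discrete).aestronglyMeasurable]
    have := Measure.isProbabilityMeasure_map (μ := μ) hX.aemeasurable
    rw [integral_fintype (Integrable.of_finite)]
    refine Finset.sum_congr rfl fun x _ => ?_
    rw [map_measureReal_apply hX .of_discrete, Complex.real_smul]
  have h2 : ‖∫ ω, ψ (X ω) ∂μ‖ ^ 2 ≤ 1 - c * ε := by
    rw [hint]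
    refine norm_sq_sum_rootsOfUnity_le he hc0 hc _ (fun x => measureReal_nonneg) ?_ _ ?_ ?_
    · rw [hfib]; simp
    · intro x
      rw [← AddChar.map_nsmul_eq_pow, heK, AddChar.map_zero_eq_one]
    · intro z
      rw [hfib]
      refine le_trans (le_of_eq ?_) (hb z)
      congr 1
      ext ω
      simp
  have h3 : ‖∫ ω, ψ (X ω) ∂μ‖ ^ 2 ≤ Real.exp (-(c / 2 * ε)) ^ 2 := by
    rw [← Real.exp_nat_mul]
    refine h2.trans ?_
    have := Real.add_one_le_exp (-(c * ε))
    calc 1 - c * ε ≤ Real.exp (-(c * ε)) := by linarith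
      _ = _ := by congr 1; push_cast; ring
  exact (sq_le_sq₀ (norm_nonneg _) (Real.exp_pos _).le).1 h3

/-- Equidistribution of a sum of independent random elements of a finite abelian group, each
nontrivial character of which is spread out on at least `k` of the summands. -/
theorem abs_prob_sum_eq_sub_inv_card_le {Ω K ι : Type*} [MeasurableSpace Ω] {μ : Measure Ω}
    [IsProbabilityMeasure μ] [AddCommGroup K] [Finite K] [MeasurableSpace K]
    [DiscreteMeasurableSpace K] [Fintype ι] {e : ℕ} (he : 0 < e) (heK : ∀ x : K, e • x = 0)
    {c ε : ℝ} (hc0 : 0 < c) (hc : ∀ z : ℂ, z ^ e = 1 → z ≠ 1 → z.re ≤ 1 - c) (hε : 0 ≤ ε)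
    {X : ι → Ω → K} (hX : ∀ i, Measurable (X i)) (hind : iIndepFun X μ) (k : ℕ)
    (hk : ∀ ψ : AddChar K ℂ, ψ ≠ 0 → ∃ s : Finset ι, k ≤ s.card ∧
      ∀ i ∈ s, ∀ z, μ.real {ω | ψ (X i ω) = z} ≤ 1 - ε) (y : K) :
    |μ.real {ω | ∑ i, X i ω = y} - (Nat.card K : ℝ)⁻¹| ≤ Real.exp (-(c / 2 * ε * k)) := by
  classical
  have := Fintype.ofFinite K
  set N : ℂ := (Fintype.card K : ℂ) with hN
  have hN0 : N ≠ 0 := by rw [hN]; exact_mod_cast Fintype.card_ne_zero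
  have hmeas : MeasurableSet {ω | ∑ i, X i ω = y} :=
    (Finset.measurable_sum _ fun i _ => hX i) (measurableSet_singleton y)
  have hψX : ∀ (ψ : AddChar K ℂ), ∫ ω, ψ (∑ i, X i ω) ∂μ = ∏ i, ∫ ω, ψ (X i ω) ∂μ := by
    intro ψ
    rw [← hind.integral_fun_prod_comp (f := fun _ x => ψ x) (fun i => (hX i).aemeasurable)
      fun i => (Measurable.of_discrete).aestronglyMeasurable]
    congr 1 with ω
    exact map_prod ψ.toMonoidHom (fun i => Multiplicative.ofAdd (X i ω)) Finset.univ
  have hbd : ∀ (ψ : AddChar K ℂ) (x : K), ‖ψ x‖ ≤ 1 := fun ψ x => by simp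
  have hI : ((μ.real {ω | ∑ i, X i ω = y} : ℝ) : ℂ)
      = N⁻¹ * ∑ ψ : AddChar K ℂ, ψ (-y) * ∏ i, ∫ ω, ψ (X i ω) ∂μ := by
    -- Orthogonality: the average of ψ(x - y) over all characters detects x = y.
    have h1 : ∀ ω, Set.indicator {ω | ∑ i, X i ω = y} (fun _ => (1 : ℂ)) ω
        = N⁻¹ * ∑ ψ : AddChar K ℂ, ψ (-y) * ψ (∑ i, X i ω) := by
      intro ω
      simp_rw [← AddChar.map_add_eq_mul]
      rw [AddChar.sum_apply_eq_ite, Set.indicator_apply]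
      by_cases h : ∑ i, X i ω = y
      · simp [h, hN0, ← hN]
      · have : -y + ∑ i, X i ω ≠ 0 := fun h' => h (by rwa [neg_add_eq_zero, eq_comm] at h')
        simp [h, this]
    have h2 : ((μ.real {ω | ∑ i, X i ω = y} : ℝ) : ℂ)
        = ∫ ω, Set.indicator {ω | ∑ i, X i ω = y} (fun _ => (1 : ℂ)) ω ∂μ := by
      rw [integral_indicator_const _ hmeas]; simp
    rw [h2]
    simp_rw [h1]
    rw [integral_const_mul, integral_finsetSum]
    · congr 1
      refine Finset.sum_congr rfl fun ψ _ => ?_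
      rw [integral_const_mul, hψX]
    · intro ψ _
      refine Integrable.const_mul ?_ _
      refine Integrable.of_bound (C := 1) ?_ (Eventually.of_forall fun ω => hbd ψ _)
      exact ((Measurable.of_discrete (f := fun x => ψ x)).comp
        (Finset.measurable_sum _ fun i _ => hX i)).aestronglyMeasurable
  have hle : ∀ ψ : AddChar K ℂ, ψ ≠ 0 →
      ‖ψ (-y) * ∏ i, ∫ ω, ψ (X i ω) ∂μ‖ ≤ Real.exp (-(c / 2 * ε * k)) := by
    intro ψ hψ
    obtain ⟨s, hs, hsb⟩ := hk ψ hψ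
    have hone : ∀ i, ‖∫ ω, ψ (X i ω) ∂μ‖ ≤ 1 := fun i => by
      simpa using norm_integral_le_of_norm_le_const (μ := μ) (C := 1)
        (Eventually.of_forall fun ω => hbd ψ (X i ω))
    rw [norm_mul, norm_prod]
    calc ‖ψ (-y)‖ * ∏ i, ‖∫ ω, ψ (X i ω) ∂μ‖
        ≤ 1 * ∏ i ∈ s, ‖∫ ω, ψ (X i ω) ∂μ‖ := by
          refine mul_le_mul ?_ ?_ (Finset.prod_nonneg fun i _ => norm_nonneg _) zero_le_one
          · exact hbd ψ _
          · rw [← Finset.prod_mul_prod_compl s]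
            exact mul_le_of_le_one_right (Finset.prod_nonneg fun i _ => norm_nonneg _)
              (Finset.prod_le_one (fun i _ => norm_nonneg _) fun i _ => hone i)
      _ ≤ 1 * ∏ i ∈ s, Real.exp (-(c / 2 * ε)) := by
          gcongr with i hi
          exact norm_integral_addChar_le he heK hc0 hc (hX i) ψ (hsb i hi)
      _ = Real.exp (-(c / 2 * ε) * s.card) := by
          rw [Finset.prod_const, one_mul, ← Real.exp_nat_mul, mul_comm]
      _ ≤ _ := by
          apply Real.exp_le_exp.2
          have : (k : ℝ) ≤ s.card := by exact_mod_cast hs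
          have h0 : 0 ≤ c / 2 * ε := by positivity
          nlinarith
  -- The trivial character contributes exactly 1/|K|. The prefactor 1/|K| then absorbs the number of
  -- remaining characters, so the bound carries no factor |K|.
  have hdiff : ((μ.real {ω | ∑ i, X i ω = y} - (Nat.card K : ℝ)⁻¹ : ℝ) : ℂ)
      = N⁻¹ * ∑ ψ ∈ Finset.univ.erase (0 : AddChar K ℂ), ψ (-y) * ∏ i, ∫ ω, ψ (X i ω) ∂μ := by
    rw [Complex.ofReal_sub, hI, ← Finset.add_sum_erase _ _ (Finset.mem_univ (0 : AddChar K ℂ)),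
      mul_add]
    simp [hN]
  have hnorm := congrArg norm hdiff
  rw [Complex.norm_real, Real.norm_eq_abs] at hnorm
  rw [hnorm, norm_mul, norm_inv]
  have hNn : ‖N‖ = Fintype.card K := by rw [hN]; simp
  have hcardpos : (0 : ℝ) < Fintype.card K := by exact_mod_cast Fintype.card_pos
  rw [hNn, inv_mul_le_iff₀ hcardpos]
  calc ‖∑ ψ ∈ Finset.univ.erase (0 : AddChar K ℂ), ψ (-y) * ∏ i, ∫ ω, ψ (X i ω) ∂μ‖
      ≤ ∑ ψ ∈ Finset.univ.erase (0 : AddChar K ℂ), Real.exp (-(c / 2 * ε * k)) :=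
        norm_sum_le_of_le _ fun ψ hψ => hle ψ (Finset.ne_of_mem_erase hψ)
    _ ≤ ∑ ψ : AddChar K ℂ, Real.exp (-(c / 2 * ε * k)) :=
        Finset.sum_le_sum_of_subset_of_nonneg (Finset.subset_univ _)
          fun _ _ _ => (Real.exp_pos _).le
    _ = _ := by rw [Finset.sum_const, Finset.card_univ, AddChar.card_eq, nsmul_eq_mul]

/-! ### Conditioning on one of two independent summands. -/

theorem measureReal_eq_sum_inter_fiber {Ω K : Type*} [MeasurableSpace Ω] {μ : Measure Ω}
    [IsProbabilityMeasure μ] [Fintype K] [MeasurableSpace K] [DiscreteMeasurableSpace K]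
    {R : Ω → K} (hR : Measurable R) (E : Set Ω) :
    μ.real E = ∑ x, μ.real (E ∩ R ⁻¹' {x}) := by
  have h := sum_measureReal_preimage_singleton (μ := μ.restrict E) (f := R) Finset.univ
    (fun y _ => hR .of_discrete)
  simp only [Finset.coe_univ, Set.preimage_univ] at h
  rw [measureReal_restrict_apply .univ, Set.univ_inter] at h
  rw [← h]
  refine Finset.sum_congr rfl fun x _ => ?_
  rw [measureReal_restrict_apply (hR .of_discrete), Set.inter_comm]

section FiniteGroupProb

variable {Ω K : Type*} [MeasurableSpace Ω] {μ : Measure Ω} [IsProbabilityMeasure μ]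
  [AddCommGroup K] [Finite K] [MeasurableSpace K] [DiscreteMeasurableSpace K]

/-- As B stays in L, a vanishing sum forces A into L; given the value of A, only one value of B
remains possible. -/
theorem IndepFun.prob_add_eq_zero_le {A B : Ω → K} (hA : Measurable A)
    (hAB : IndepFun A B μ) (L : AddSubgroup K) (hBL : ∀ ω, B ω ∈ L) {b : ℝ}
    (hb : ∀ y ∈ L, μ.real {ω | B ω = y} ≤ b) :
    μ.real {ω | A ω + B ω = 0} ≤ μ.real {ω | A ω ∈ L} * b := by
  classical
  have := Fintype.ofFinite K
  rw [measureReal_eq_sum_inter_fiber hA, measureReal_eq_sum_inter_fiber hA {ω | A ω ∈ L},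
    Finset.sum_mul]
  refine Finset.sum_le_sum fun x _ => ?_
  by_cases hx : x ∈ L
  · have h1 : {ω | A ω + B ω = 0} ∩ A ⁻¹' {x} = A ⁻¹' {x} ∩ B ⁻¹' {-x} := by
      ext ω
      simp only [Set.mem_inter_iff, Set.mem_ofPred_eq, Set.mem_preimage, Set.mem_singleton_iff]
      constructor
      · rintro ⟨h, rfl⟩; exact ⟨rfl, (neg_eq_of_add_eq_zero_right h).symm⟩
      · rintro ⟨rfl, h⟩; exact ⟨by rw [h, add_neg_cancel], rfl⟩
    have h2 : {ω | A ω ∈ L} ∩ A ⁻¹' {x} = A ⁻¹' {x} := by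
      ext ω
      simp only [Set.mem_inter_iff, Set.mem_ofPred_eq, Set.mem_preimage, Set.mem_singleton_iff]
      exact ⟨fun h => h.2, fun h => ⟨h ▸ hx, h⟩⟩
    rw [h1, h2, measureReal_def,
      hAB.measure_inter_preimage_eq_mul _ _ .of_discrete .of_discrete, ENNReal.toReal_mul]
    exact mul_le_mul_of_nonneg_left (hb _ (L.neg_mem hx)) ENNReal.toReal_nonneg
  · have h1 : {ω | A ω + B ω = 0} ∩ A ⁻¹' {x} = ∅ := by
      ext ω
      simp only [Set.mem_inter_iff, Set.mem_ofPred_eq, Set.mem_preimage, Set.mem_singleton_iff,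
        Set.mem_empty_iff_false, iff_false, not_and]
      rintro h rfl
      exact hx (by rw [eq_neg_of_add_eq_zero_left h]; exact L.neg_mem (hBL ω))
    have hb0 : 0 ≤ b := measureReal_nonneg.trans (hb 0 L.zero_mem)
    rw [h1, measureReal_empty]
    exact mul_nonneg measureReal_nonneg hb0

theorem IndepFun.prob_add_mem_le {X R : Ω → K} (hR : Measurable R)
    (hXR : IndepFun X R μ) (L : Set K) {b : ℝ} (hb : ∀ r, μ.real {ω | X ω + r ∈ L} ≤ b) :
    μ.real {ω | X ω + R ω ∈ L} ≤ b := by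
  classical
  have := Fintype.ofFinite K
  have h1 : ∀ x, μ.real ({ω | X ω + R ω ∈ L} ∩ R ⁻¹' {x})
      = μ.real {ω | X ω + x ∈ L} * μ.real (R ⁻¹' {x}) := by
    intro x
    have : {ω | X ω + R ω ∈ L} ∩ R ⁻¹' {x} = X ⁻¹' {y | y + x ∈ L} ∩ R ⁻¹' {x} := by
      ext ω
      simp only [Set.mem_inter_iff, Set.mem_ofPred_eq, Set.mem_preimage, Set.mem_singleton_iff]
      constructor <;> · rintro ⟨h, rfl⟩; exact ⟨h, rfl⟩
    rw [this, measureReal_def,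
      hXR.measure_inter_preimage_eq_mul _ _ .of_discrete .of_discrete, ENNReal.toReal_mul]
    rfl
  rw [measureReal_eq_sum_inter_fiber hR]
  simp_rw [h1]
  calc ∑ x, μ.real {ω | X ω + x ∈ L} * μ.real (R ⁻¹' {x})
      ≤ ∑ x, b * μ.real (R ⁻¹' {x}) := by
        gcongr with x _; exact hb x
    _ = b := by
        rw [← Finset.mul_sum, sum_measureReal_preimage_singleton _ fun y _ => hR .of_discrete]
        simp

end FiniteGroupProb

theorem iIndepFun.indepFun_sum_sum {Ω K ι : Type*} [MeasurableSpace Ω] {μ : Measure Ω}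
    [AddCommGroup K] [Finite K] [MeasurableSpace K] [DiscreteMeasurableSpace K]
    {Y : ι → Ω → K} (hY : ∀ i, Measurable (Y i))
    (h : iIndepFun Y μ) {S T : Finset ι} (hST : Disjoint S T) :
    IndepFun (fun ω => ∑ i ∈ S, Y i ω) (fun ω => ∑ i ∈ T, Y i ω) μ := by
  have h1 := (h.indepFun_finset S T hST hY).comp
    (φ := fun v : S → K => ∑ i, v i) (ψ := fun v : T → K => ∑ i, v i)
    (Finset.measurable_sum _ fun i _ => measurable_pi_apply i)
    (Finset.measurable_sum _ fun i _ => measurable_pi_apply i)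
  convert h1 using 2 with ω ω
  · exact (Finset.sum_coe_sort S fun i => Y i ω).symm
  · exact (Finset.sum_coe_sort T fun i => Y i ω).symm

/-- A set with all differences in H lies in a single coset of H. This form suits level sets of
characters and preimages of cosets. -/
theorem IsEpsBalanced.prob_mem_le {Ω A : Type*} [MeasurableSpace Ω] {μ : Measure Ω}
    [IsProbabilityMeasure μ] [AddCommGroup A] {X : Ω → A} {ε : ℝ} (h : IsEpsBalanced μ X ε)
    {H : AddSubgroup A} (hH : H ≠ ⊤) {S : Set A} (hS : ∀ x ∈ S, ∀ y ∈ S, y - x ∈ H) :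
    μ.real {ω | X ω ∈ S} ≤ 1 - ε := by
  rcases S.eq_empty_or_nonempty with rfl | ⟨x, hx⟩
  · simpa using measureReal_nonneg.trans (h H hH 0)
  · refine (measureReal_mono fun ω hω => ?_).trans (h H hH x)
    rw [Set.mem_ofPred_eq, Set.mem_vadd_set]
    exact ⟨X ω - x, hS x hx _ hω, by simp⟩

/-! ### Row-block contributions to fM over one column block. -/

section Combination

variable {I J R G : Type*} [Fintype I] [CommRing R] [AddCommGroup G] [Module R G]

/-- The vector `(∑ i, A i j • g i)_j` of combinations of the `g i` with coefficients in the columns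
of `A`. -/
def columnCombination (g : I → G) : Matrix I J R →+ (J → G) where
  toFun A j := ∑ i, A i j • g i
  map_zero' := by ext; simp
  map_add' A B := by ext; simp [add_smul, Finset.sum_add_distrib]

theorem columnCombination_apply (g : I → G) (A : Matrix I J R) (j : J) :
    columnCombination g A j = ∑ i, A i j • g i := rfl

theorem columnCombination_single [DecidableEq I] [DecidableEq J] (g : I → G) (i : I) (j : J)
    (r : R) : columnCombination g (Matrix.single i j r) = Pi.single j (r • g i) := by
  ext j'
  rw [columnCombination_apply, Finset.sum_eq_single i]
  · rcases eq_or_ne j j' with rfl | h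
    · simp
    · simp [h, h.symm]
  · intro b _ hb; simp [hb.symm]
  · simp

end Combination

section Blocks

variable {Ω ι J R : Type*} [MeasurableSpace Ω] {μ : Measure Ω} [IsProbabilityMeasure μ]
  [Fintype ι] {I : ι → Type*} [∀ s, Fintype (I s)] [Fintype J] [CommRing R]
  {e : ℕ} {c ε : ℝ}

/-- Equidistribution for codes: if a character were trivial on all but fewer than k blocks, the
remaining entries would still span, and the character would be trivial. -/
theorem abs_prob_sum_columnCombination_sub_le {H : Type*} [AddCommGroup H] [Module R H] [Finite H]
    [MeasurableSpace H] [DiscreteMeasurableSpace H] (he : 0 < e) (heH : ∀ x : H, e • x = 0)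
    (hc0 : 0 < c) (hc : ∀ z : ℂ, z ^ e = 1 → z ≠ 1 → z.re ≤ 1 - c) (hε : 0 ≤ ε)
    (B : ∀ s, Ω → Matrix (I s) J R) (hB : ∀ s, IsEpsBalanced μ (B s) ε) (g : ∀ s, I s → H)
    (hm : ∀ s, Measurable fun ω => columnCombination (g s) (B s ω))
    (hind : iIndepFun (fun s ω => columnCombination (g s) (B s ω)) μ) (k : ℕ)
    (hk : ∀ τ : Finset ι, τ.card < k →
      Submodule.span R {x | ∃ s ∉ τ, ∃ i, g s i = x} = ⊤) (y : J → H) :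
    |μ.real {ω | ∑ s, columnCombination (g s) (B s ω) = y}
      - ((Nat.card H : ℝ) ^ Fintype.card J)⁻¹| ≤ Real.exp (-(c / 2 * ε * k)) := by
  classical
  have hcard : ((Nat.card H : ℝ) ^ Fintype.card J) = (Nat.card (J → H) : ℝ) := by
    rw [Nat.card_fun]; simp
  rw [hcard]
  refine abs_prob_sum_eq_sub_inv_card_le he (fun x => by ext j; exact heH _) hc0 hc hε hm hind k
    (fun ψ hψ => ?_) y
  refine ⟨Finset.univ.filter fun s => ∃ A : Matrix (I s) J R, ψ (columnCombination (g s) A) ≠ 1,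
    ?_, ?_⟩
  · by_contra! hlt
    apply hψ
    have htop := hk _ hlt
    -- All multiples r • x are tested so that V is closed under scalars. V contains every entry of
    -- the blocks on which ψ is trivial, hence is everything.
    let V : Submodule R H :=
      { carrier := {x | ∀ (j : J) (r : R), ψ (Pi.single j (r • x)) = 1}
        zero_mem' := by intro j r; simp
        add_mem' := by
          intro x x' hx hx' j r
          rw [smul_add, Pi.single_add, AddChar.map_add_eq_mul, hx, hx', one_mul]
        smul_mem' := by
          intro r' x hx j r
          rw [smul_smul]; exact hx j _ }
    have hV : V = ⊤ := by
      rw [eq_top_iff, ← htop, Submodule.span_le]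
      rintro x ⟨s, hs, i, rfl⟩ j r
      simp only [Finset.mem_filter, Finset.mem_univ, true_and, not_exists, not_not] at hs
      rw [← columnCombination_single]
      exact hs _
    ext v
    rw [← Finset.univ_sum_single v, AddChar.zero_apply]
    have h1 := map_prod ψ.toMonoidHom
      (fun j => Multiplicative.ofAdd (Pi.single j (v j) : J → H)) Finset.univ
    refine h1.trans (Finset.prod_eq_one fun j _ => ?_)
    have : v j ∈ V := by rw [hV]; trivial
    simpa using this j 1
  · intro s hs z
    simp only [Finset.mem_filter, Finset.mem_univ, true_and] at hs
    obtain ⟨A, hA⟩ := hs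
    -- Each level set of ψ on this block lies in a coset of the kernel D, which is proper because of
    -- A.
    let D : AddSubgroup (Matrix (I s) J R) :=
      { carrier := {A | ψ (columnCombination (g s) A) = 1}
        zero_mem' := by simp
        add_mem' := by
          intro x y hx hy
          simp only [Set.mem_ofPred_eq] at *
          rw [map_add, AddChar.map_add_eq_mul, hx, hy, one_mul]
        neg_mem' := by
          intro x hx
          simp only [Set.mem_ofPred_eq] at *
          rw [map_neg, AddChar.map_neg_eq_inv, hx, inv_one] }
    have hD : D ≠ ⊤ := by
      intro h
      have : A ∈ D := by rw [h]; trivial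
      exact hA this
    refine (hB s).prob_mem_le hD (S := {A | ψ (columnCombination (g s) A) = z}) ?_
    intro x hx y hy
    change ψ _ = 1
    have hz : z ≠ 0 := by
      rw [← show _ = z from hx]
      intro h0
      have := AddChar.norm_apply ψ (columnCombination (g s) x)
      rw [h0] at this
      simp at this
    rw [map_sub, AddChar.map_sub_eq_div, show _ = z from hx, show _ = z from hy, div_self hz]

/-- The sum over σ must fall into H^J, which the block leaving H allows with probability at most 1 -
ε. Independently, the sum over the other blocks must hit one prescribed point of H^J, where it is
nearly uniform. -/
theorem prob_sum_columnCombination_eq_zero_le {G : Type*} [AddCommGroup G] [Module R G] [Finite G]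
    [MeasurableSpace G] [DiscreteMeasurableSpace G] [Nonempty J] [DecidableEq ι]
    (he : 0 < e) (heG : ∀ x : G, e • x = 0)
    (hc0 : 0 < c) (hc : ∀ z : ℂ, z ^ e = 1 → z ≠ 1 → z.re ≤ 1 - c) (hε : 0 ≤ ε)
    (B : ∀ s, Ω → Matrix (I s) J R) (hB : ∀ s, IsEpsBalanced μ (B s) ε) (f : ∀ s, I s → G)
    (hm : ∀ s, Measurable fun ω => columnCombination (f s) (B s ω))
    (hind : iIndepFun (fun s ω => columnCombination (f s) (B s ω)) μ) (k : ℕ)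
    (H : Submodule R G) (σ : Finset ι) (hσ : ∀ s ∉ σ, ∀ i, f s i ∈ H)
    (hout : ∃ s i, f s i ∉ H)
    (hk : ∀ τ : Finset ι, τ.card < k →
      Submodule.span R {x | ∃ s ∉ σ ∪ τ, ∃ i, f s i = x} = H) :
    μ.real {ω | ∑ s, columnCombination (f s) (B s ω) = 0}
      ≤ (1 - ε) * (((Nat.card H : ℝ) ^ Fintype.card J)⁻¹ + Real.exp (-(c / 2 * ε * k))) := by
  classical
  set Y : ι → Ω → (J → G) := fun s ω => columnCombination (f s) (B s ω) with hY
  obtain ⟨s₀, i₀, hi₀⟩ := hout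
  have hs₀ : s₀ ∈ σ := by by_contra h; exact hi₀ (hσ s₀ h i₀)
  let L : AddSubgroup (J → G) := (Submodule.pi Set.univ fun _ : J => H).toAddSubgroup
  have hL : ∀ v : J → G, v ∈ L ↔ ∀ j, v j ∈ H := fun v => by simp [L, Submodule.mem_pi]
  have hYL : ∀ s ∉ σ, ∀ ω, Y s ω ∈ L := by
    intro s hs ω
    rw [hL]
    exact fun j => H.sum_mem fun i _ => H.smul_mem _ (hσ s hs i)
  have hsplit : ∀ ω, ∑ s, Y s ω = ∑ s ∈ σ, Y s ω + ∑ s ∈ σᶜ, Y s ω := fun ω =>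
    (Finset.sum_add_sum_compl σ _).symm
  have hsplit' : ∀ ω, ∑ s ∈ σ, Y s ω = ∑ s ∈ {s₀}, Y s ω + ∑ s ∈ σ.erase s₀, Y s ω := fun ω => by
    rw [Finset.sum_singleton, Finset.add_sum_erase σ (fun s => Y s ω) hs₀]
  have hmeas : ∀ S : Finset ι, Measurable fun ω => ∑ s ∈ S, Y s ω := fun S =>
    Finset.measurable_sum _ fun s _ => hm s
  have hfirst : μ.real {ω | ∑ s ∈ σ, Y s ω ∈ L} ≤ 1 - ε := by
    simp_rw [hsplit']
    refine IndepFun.prob_add_mem_le (hmeas _)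
      (iIndepFun.indepFun_sum_sum hm hind (by simp)) L fun r => ?_
    simp_rw [Finset.sum_singleton]
    refine (hB s₀).prob_mem_le (H := L.comap (columnCombination (f s₀))) ?_
      (S := {A | columnCombination (f s₀) A + r ∈ L}) ?_
    -- The matrix unit at (i₀, j) is sent outside L, so the preimage of L is proper; this needs a
    -- column j.
    · intro h
      obtain ⟨j⟩ := ‹Nonempty J›
      have h1 : Matrix.single i₀ j (1 : R) ∈ L.comap (columnCombination (f s₀)) := by
        rw [h]; trivial
      rw [AddSubgroup.mem_comap, columnCombination_single, hL] at h1
      exact hi₀ (by simpa using h1 j)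
    · intro x hx y hy
      rw [AddSubgroup.mem_comap, map_sub]
      have := L.sub_mem hy hx
      simpa using this
  have hsecond : ∀ y ∈ L, μ.real {ω | ∑ s ∈ σᶜ, Y s ω = y}
      ≤ ((Nat.card H : ℝ) ^ Fintype.card J)⁻¹ + Real.exp (-(c / 2 * ε * k)) := by
    intro y hy
    rw [hL] at hy
    let g : ∀ s : {s // s ∉ σ}, I s → H := fun s i => ⟨f s i, hσ s s.2 i⟩
    have hgv : ∀ (s : {s // s ∉ σ}) ω j,
        ((columnCombination (g s) (B s ω) j : H) : G) = Y s ω j := by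
      intro s ω j
      simp [hY, columnCombination_apply, g]
    -- The H-valued contribution is a function of the G-valued one, so it inherits measurability and
    -- independence.
    have hgm : ∀ s : {s // s ∉ σ}, ∃ F : (J → G) → (J → H), ∀ ω,
        columnCombination (g s) (B s ω) = F (Y s ω) := by
      intro s
      refine ⟨fun v j => if h : v j ∈ H then ⟨v j, h⟩ else 0, fun ω => ?_⟩
      ext j
      have h1 : Y s ω j ∈ H := (hL _).1 (hYL s s.2 ω) j
      rw [hgv]
      simp only [dif_pos h1]
    choose F hF using hgm
    have key := abs_prob_sum_columnCombination_sub_le (μ := μ) (H := H) he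
      (fun x => Subtype.ext (by simpa using heG x)) hc0 hc hε (fun s : {s // s ∉ σ} => B s)
      (fun s => hB s) g
      (fun s => by
        simp_rw [hF]
        exact (Measurable.of_discrete (f := F s)).comp (hm s))
      (by
        have h1 := (hind.precomp (g := fun s : {s // s ∉ σ} => (s : ι))
          Subtype.val_injective).comp F (fun s => .of_discrete)
        convert h1 using 2 with s
        ext1 ω
        exact hF s ω) k
      (fun τ hτ => by
        have h1 := hk (τ.map ⟨Subtype.val, Subtype.val_injective⟩) (by simpa using hτ)
        apply Submodule.map_injective_of_injective (f := H.subtype) H.injective_subtype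
        rw [Submodule.map_span, Submodule.map_subtype_top]
        refine Eq.trans ?_ h1
        congr 1
        ext x
        simp only [Set.mem_image, Set.mem_ofPred_eq, Finset.mem_union, Finset.mem_map,
          Function.Embedding.coeFn_mk, not_or]
        constructor
        · rintro ⟨_, ⟨s, hs, i, rfl⟩, rfl⟩
          refine ⟨s, ⟨s.2, ?_⟩, i, rfl⟩
          rintro ⟨s', hs', h⟩
          exact hs (Subtype.ext h ▸ hs')
        · rintro ⟨s, ⟨hs1, hs2⟩, i, rfl⟩
          exact ⟨g ⟨s, hs1⟩ i, ⟨⟨s, hs1⟩, fun h => hs2 ⟨_, h, rfl⟩, i, rfl⟩, rfl⟩)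
      (fun j => ⟨y j, hy j⟩)
    have hev : {ω | ∑ s ∈ σᶜ, Y s ω = y} = {ω | ∑ s : {s // s ∉ σ},
        columnCombination (g s) (B s ω) = fun j => (⟨y j, hy j⟩ : H)} := by
      ext ω
      have h1 : ∀ j, ((∑ s : {s // s ∉ σ}, columnCombination (g s) (B s ω)) j : G)
          = (∑ s ∈ σᶜ, Y s ω) j := by
        intro j
        rw [Finset.sum_apply, Finset.sum_apply, AddSubmonoidClass.coe_finsetSum]
        simp_rw [hgv]
        exact (Finset.sum_subtype σᶜ (by simp) fun s => Y s ω j).symm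
      simp only [Set.mem_ofPred_eq]
      constructor
      · intro h; ext j; rw [h1, h]
      · intro h; ext j; rw [← h1, h]
    rw [hev]
    linarith [(abs_le.1 key).2]
  have hε1 : 0 ≤ 1 - ε := measureReal_nonneg.trans hfirst
  have hb0 := measureReal_nonneg.trans (hsecond 0 L.zero_mem)
  have hY0 : {ω | ∑ s, columnCombination (f s) (B s ω) = 0}
      = {ω | ∑ s ∈ σ, Y s ω + ∑ s ∈ σᶜ, Y s ω = 0} := by
    ext ω
    rw [Set.mem_ofPred_eq, Set.mem_ofPred_eq, ← hsplit]
  rw [hY0]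
  refine (IndepFun.prob_add_eq_zero_le (hmeas σ)
    (iIndepFun.indepFun_sum_sum hm hind disjoint_compl_right) L
    (fun ω => L.sum_mem fun s hs => hYL s (by simpa using hs) ω) hsecond).trans ?_
  exact mul_le_mul_of_nonneg_right hfirst hb0

end Blocks

/-! ### Codes, robust spans, and counting the exceptional tuples. -/

section Codes

variable {R G ι : Type*} [CommRing R] [AddCommGroup G] [Module R G] [Finite G]
  {I : ι → Type*}

/-- Every family of generators indexed by blocks becomes, after removal of boundedly many blocks,
a family whose span does not change upon removal of fewer than `k` further blocks. -/
theorem exists_robust_span [DecidableEq ι] (f : ∀ s, I s → G) (k : ℕ) :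
    (∀ τ : Finset ι, τ.card < k → Submodule.span R {x | ∃ s ∉ τ, ∃ i, f s i = x} = ⊤) ∨
      ∃ H : Submodule R G, H ≠ ⊤ ∧ ∃ σ : Finset ι, σ.card ≤ k * Nat.card G ∧
        (∀ s ∉ σ, ∀ i, f s i ∈ H) ∧
        ∀ τ : Finset ι, τ.card < k →
          Submodule.span R {x | ∃ s ∉ σ ∪ τ, ∃ i, f s i = x} = H := by
  set V : Finset ι → Submodule R G := fun σ => Submodule.span R {x | ∃ s ∉ σ, ∃ i, f s i = x}
    with hV
  have hle : ∀ σ, Nat.card (V σ) ≤ Nat.card G := fun σ =>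
    Nat.card_le_card_of_injective _ Subtype.val_injective
  -- Budget argument: deleting fewer than k blocks that shrink the span costs less than k and lowers
  -- k|V| by at least k, so it stays admissible. A minimizer of |V| is therefore robust.
  have hne : {σ : Finset ι | σ.card + k * Nat.card (V σ) ≤ k * Nat.card G}.Nonempty :=
    ⟨∅, by simpa using Nat.mul_le_mul_left k (hle ∅)⟩
  set σ := Function.argminOn (fun σ => Nat.card (V σ)) _ hne with hσ
  have hmem : σ.card + k * Nat.card (V σ) ≤ k * Nat.card G :=
    Function.argminOn_mem (fun σ => Nat.card (V σ)) _ hne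
  have hanti : ∀ τ, V (σ ∪ τ) ≤ V σ := fun τ => by
    apply Submodule.span_mono
    rintro x ⟨s, hs, i, rfl⟩
    exact ⟨s, fun h => hs (Finset.mem_union_left _ h), i, rfl⟩
  have hrob : ∀ τ : Finset ι, τ.card < k → V (σ ∪ τ) = V σ := by
    intro τ hτ
    by_contra hne'
    have hlt : Nat.card (V (σ ∪ τ)) < Nat.card (V σ) := by
      have h1 : (V (σ ∪ τ) : Set G) ⊂ V σ := lt_of_le_of_ne (hanti τ) fun h =>
        hne' (SetLike.coe_injective h)
      exact Set.Finite.card_lt_card (Set.toFinite _) h1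
    refine Function.not_lt_argminOn (fun σ => Nat.card (V σ)) _ ?_ hlt
    change (σ ∪ τ).card + k * Nat.card (V (σ ∪ τ)) ≤ k * Nat.card G
    have h2 := Finset.card_union_le σ τ
    have h3 := Nat.mul_le_mul_left k (Nat.succ_le_of_lt hlt)
    rw [Nat.mul_succ] at h3
    omega
  by_cases htop : V σ = ⊤
  · left
    have hc : Nat.card (V σ) = Nat.card G := by
      rw [htop]; exact Nat.card_congr Submodule.topEquiv.toEquiv
    -- If the span is still G, the budget leaves no room for deleted blocks.
    have hσ0 : σ = ∅ := by
      rw [hc] at hmem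
      exact Finset.card_eq_zero.1 (by omega)
    intro τ hτ
    have := hrob τ hτ
    rw [hσ0, Finset.empty_union, ← hσ0, htop] at this
    exact this
  · right
    refine ⟨V σ, htop, σ, by omega, fun s hs i => Submodule.subset_span ⟨s, hs, i, rfl⟩, hrob⟩

/-- Each such subset is listed in m slots, with unused slots filled by `none`. -/
theorem card_finset_card_le (ι : Type*) [Fintype ι] [DecidableEq ι] (m : ℕ) :
    (Finset.univ.filter fun σ : Finset ι => σ.card ≤ m).card ≤ (Fintype.card ι + 1) ^ m := by
  have hcard : Fintype.card (Fin m → Option ι) = (Fintype.card ι + 1) ^ m := by simp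
  rw [← hcard, ← Finset.card_univ]
  refine (Finset.card_le_card ?_).trans
    (Finset.card_image_le (f := fun g : Fin m → Option ι => (Finset.univ.image g).eraseNone))
  intro σ hσ
  rw [Finset.mem_filter] at hσ
  rw [Finset.mem_image]
  refine ⟨fun j => if h : (j : ℕ) < σ.card then some (σ.equivFin.symm ⟨j, h⟩) else none,
    Finset.mem_univ _, ?_⟩
  ext x
  simp only [Finset.mem_eraseNone, Finset.mem_image, Finset.mem_univ, true_and]
  constructor
  · rintro ⟨j, hj⟩
    split_ifs at hj with h
    rw [← Option.some_injective _ hj]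
    exact (σ.equivFin.symm ⟨j, h⟩).2
  · intro hx
    refine ⟨⟨σ.equivFin ⟨x, hx⟩, (σ.equivFin ⟨x, hx⟩).2.trans_le hσ.2⟩, ?_⟩
    simp

theorem card_pi_mem_of_notMem {n : ℕ} [Fintype G] [DecidableEq G] (H : Submodule R G)
    [DecidablePred (· ∈ H)] (r : Finset (Fin n)) :
    (Finset.univ.filter fun f : Fin n → G => ∀ i ∉ r, f i ∈ H).card
      ≤ Nat.card G ^ r.card * Nat.card H ^ n := by
  have h1 : (Finset.univ.filter fun f : Fin n → G => ∀ i ∉ r, f i ∈ H)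
      = Fintype.piFinset fun i => if i ∈ r then Finset.univ else Finset.univ.filter (· ∈ H) := by
    ext f
    simp only [Finset.mem_filter, Finset.mem_univ, true_and, Fintype.mem_piFinset]
    refine forall_congr' fun i => ?_
    split_ifs with h <;> simp [h]
  have hH : (Finset.univ.filter (· ∈ H)).card = Nat.card H := by
    rw [Nat.card_eq_fintype_card, Fintype.card_subtype]
  have hH1 : 1 ≤ Nat.card H := Nat.card_pos
  rw [h1, Fintype.card_piFinset]
  calc ∏ i, (if i ∈ r then Finset.univ else Finset.univ.filter (· ∈ H)).card
      ≤ ∏ i, ((if i ∈ r then Nat.card G else 1) * Nat.card H) := by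
        refine Finset.prod_le_prod' fun i _ => ?_
        split_ifs
        · rw [Finset.card_univ, Nat.card_eq_fintype_card]
          exact Nat.le_mul_of_pos_right _ hH1
        · rw [hH, one_mul]
    _ = Nat.card G ^ r.card * Nat.card H ^ n := by
        rw [Finset.prod_mul_distrib]
        simp

/-- Union bound over σ: its blocks cover at most m * h indices, where values are free in G, and
elsewhere values lie in H. -/
theorem card_exists_pi_mem_le {n : ℕ} [Fintype G] [DecidableEq G]
    (P : Finpartition (Finset.univ : Finset (Fin n))) {h : ℕ} (hP : ∀ S ∈ P.parts, S.card ≤ h)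
    (H : Submodule R G) (m : ℕ)
    [DecidablePred fun f : Fin n → G => ∃ σ : Finset P.parts, σ.card ≤ m ∧
      ∀ s ∉ σ, ∀ i : (s : Finset (Fin n)), f i ∈ H] :
    (Finset.univ.filter fun f : Fin n → G => ∃ σ : Finset P.parts, σ.card ≤ m ∧
      ∀ s ∉ σ, ∀ i : (s : Finset (Fin n)), f i ∈ H).card
      ≤ (n + 1) ^ m * Nat.card G ^ (m * h) * Nat.card H ^ n := by
  classical
  have hsub : (Finset.univ.filter fun f : Fin n → G => ∃ σ : Finset P.parts, σ.card ≤ m ∧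
      ∀ s ∉ σ, ∀ i : (s : Finset (Fin n)), f i ∈ H) ⊆
      (Finset.univ.filter fun σ : Finset P.parts => σ.card ≤ m).biUnion fun σ =>
        Finset.univ.filter fun f : Fin n → G =>
          ∀ i ∉ σ.biUnion fun s => (s : Finset (Fin n)), f i ∈ H := by
    intro f hf
    simp only [Finset.mem_filter, Finset.mem_univ, true_and, Finset.mem_biUnion] at hf ⊢
    obtain ⟨σ, hσ, hfσ⟩ := hf
    refine ⟨σ, hσ, fun i hi => ?_⟩
    obtain ⟨S, hS, hiS⟩ := P.exists_mem (Finset.mem_univ i)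
    exact hfσ ⟨S, hS⟩ (fun hmem => hi ⟨_, hmem, hiS⟩) ⟨i, hiS⟩
  refine (Finset.card_le_card hsub).trans (Finset.card_biUnion_le.trans ?_)
  have hterm : ∀ σ ∈ Finset.univ.filter fun σ : Finset P.parts => σ.card ≤ m,
      (Finset.univ.filter fun f : Fin n → G =>
        ∀ i ∉ σ.biUnion fun s => (s : Finset (Fin n)), f i ∈ H).card
        ≤ Nat.card G ^ (m * h) * Nat.card H ^ n := by
    intro σ hσ
    refine (card_pi_mem_of_notMem H _).trans (Nat.mul_le_mul_right _ ?_)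
    refine Nat.pow_le_pow_right Nat.card_pos ?_
    refine Finset.card_biUnion_le.trans ((Finset.sum_le_card_nsmul _ _ h
      fun (s : P.parts) _ => hP s s.2).trans ?_)
    exact Nat.mul_le_mul_right h (Finset.mem_filter.1 hσ).2
  refine (Finset.sum_le_card_nsmul _ _ _ hterm).trans ?_
  rw [smul_eq_mul, mul_assoc]
  refine Nat.mul_le_mul_right _ ((card_finset_card_le _ _).trans ?_)
  refine Nat.pow_le_pow_left ?_ m
  have := P.card_parts_le_card
  simp only [Finset.card_univ, Fintype.card_fin] at this
  simpa using this

end Codes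

/-! ### Surjections as spanning tuples, and factorization over column blocks. -/

/-- A homomorphism is determined by the images of the basis vectors, subject to killing the columns.
Additive maps of ℤ/aℤ-modules are automatically linear, so surjectivity becomes a condition on a
span. -/
theorem numSur_matrixCoker {m n a : ℕ} {G : Type*} [AddCommGroup G] [Module (ZMod a) G]
    (A : Matrix (Fin m) (Fin n) (ZMod a)) :
    numSur (matrixCoker A) G = Nat.card {f : Fin m → G //
      Submodule.span (ZMod a) (Set.range f) = ⊤ ∧ ∀ j, ∑ i, A i j • f i = 0} := by
  have hlift : ∀ f : Fin m → G, (∀ j, ∑ i, A i j • f i = 0) →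
      LinearMap.range A.mulVecLin ≤ LinearMap.ker (Fintype.linearCombination (ZMod a) f) := by
    rintro f hf _ ⟨v, rfl⟩
    rw [LinearMap.mem_ker, Fintype.linearCombination_apply]
    simp only [Matrix.mulVecLin_apply, Matrix.mulVec, dotProduct, Finset.sum_smul]
    rw [Finset.sum_comm]
    refine Finset.sum_eq_zero fun j _ => ?_
    simp_rw [mul_comm (A _ j), mul_smul, ← Finset.smul_sum, hf, smul_zero]
  have hcomb : ∀ (g : matrixCoker A →+ G) (v : Fin m → ZMod a),
      g (Submodule.Quotient.mk v)
        = Fintype.linearCombination (ZMod a)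
          (fun i => g (Submodule.Quotient.mk (Pi.single i 1))) v := by
    intro g v
    have h := LinearMap.pi_apply_eq_sum_univ
      ((g.toZModLinearMap a).comp (Submodule.mkQ (LinearMap.range A.mulVecLin))) v
    rw [Fintype.linearCombination_apply]
    refine Eq.trans h (Finset.sum_congr rfl fun i _ => ?_)
    congr 1
    simp only [LinearMap.comp_apply, Submodule.mkQ_apply, AddMonoidHom.coe_toZModLinearMap]
    congr 2
    ext j
    simp [Pi.single_apply, eq_comm]
  symm
  refine Nat.card_congr (Equiv.symm ⟨fun g => ⟨fun i => g.1 (Submodule.Quotient.mk (Pi.single i 1)),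
    ?_, ?_⟩, fun f => ⟨((LinearMap.range A.mulVecLin).liftQ
      (Fintype.linearCombination (ZMod a) f.1) (hlift _ f.2.2)).toAddMonoidHom, ?_⟩, ?_, ?_⟩)
  · rw [← Fintype.range_linearCombination, LinearMap.range_eq_top]
    intro x
    obtain ⟨y, hy⟩ := g.2 x
    obtain ⟨v, rfl⟩ := Submodule.Quotient.mk_surjective _ y
    exact ⟨v, by rw [← hcomb, hy]⟩
  · intro j
    have h1 := hcomb g.1 (A.mulVecLin (Pi.single j 1))
    rw [(Submodule.Quotient.mk_eq_zero _).2 (LinearMap.mem_range_self _ _), map_zero,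
      Fintype.linearCombination_apply] at h1
    simpa using h1.symm
  · have h1 := f.2.1
    rw [← Fintype.range_linearCombination, LinearMap.range_eq_top] at h1
    intro x
    obtain ⟨v, hv⟩ := h1 x
    exact ⟨Submodule.Quotient.mk v, hv⟩
  · intro g
    ext x
    obtain ⟨v, rfl⟩ := Submodule.Quotient.mk_surjective _ x
    exact (hcomb g.1 v).symm
  · intro f
    ext i
    change Fintype.linearCombination (ZMod a) f.1 (Pi.single i 1) = f.1 i
    simp [Fintype.linearCombination_apply_single]

/-- Disjoint groups of independent σ-algebras generate independent σ-algebras; groups are peeled off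
one at a time. Here a group collects the blocks in one column block. -/
theorem iIndep.prob_biInter_groups {Ω ι κ : Type*} {mΩ : MeasurableSpace Ω} {μ : Measure Ω}
    [IsProbabilityMeasure μ] {m : ι → MeasurableSpace Ω} (hle : ∀ i, m i ≤ mΩ) (hm : iIndep m μ)
    (π : ι → κ) (E : κ → Set Ω) (hE : ∀ T, MeasurableSet[⨆ i ∈ {i | π i = T}, m i] (E T))
    (s : Finset κ) : μ.real (⋂ T ∈ s, E T) = ∏ T ∈ s, μ.real (E T) := by
  classical
  induction s using Finset.induction_on with
  | empty => simp
  | insert T s hT ih =>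
    have hind := indep_iSup_of_disjoint hle hm (S := {i | π i = T}) (T := {i | π i ∈ s})
      (Set.disjoint_left.2 fun i hi hi' => hT (hi ▸ hi'))
    have h2 : MeasurableSet[⨆ i ∈ {i | π i ∈ s}, m i] (⋂ T ∈ s, E T) := by
      refine MeasurableSet.biInter s.countable_toSet fun T' hT' => ?_
      refine (biSup_mono fun i hi => ?_ :
        (⨆ i ∈ {i | π i = T'}, m i) ≤ ⨆ i ∈ {i | π i ∈ s}, m i) _ (hE T')
      simpa [show π i = T' from hi] using hT'
    rw [Finset.set_biInter_insert, Finset.prod_insert hT, ← ih, measureReal_def,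
      (Indep_iff _ _ μ).1 hind _ _ (hE T) h2, ENNReal.toReal_mul]
    rfl

section BalancedMatrix

variable {Ω : Type*} [MeasurableSpace Ω] {μ : Measure Ω} [IsProbabilityMeasure μ] {n m a : ℕ}
  {G : Type*} [AddCommGroup G] [Module (ZMod a) G] [Finite G]

theorem sum_parts_columnCombination {R G : Type*} [CommRing R] [AddCommGroup G] [Module R G]
    (P : Finpartition (Finset.univ : Finset (Fin n))) (f : Fin n → G)
    (A : Matrix (Fin n) (Fin m) R) (T : Finset (Fin m)) (j : T) :
    (∑ s : P.parts, columnCombination (fun i : (s : Finset (Fin n)) => f i) (matrixBlock A s T)) j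
      = ∑ i, A i j • f i := by
  classical
  rw [Finset.sum_apply]
  have h1 : ∀ s : P.parts,
      columnCombination (fun i : (s : Finset (Fin n)) => f i) (matrixBlock A s T) j
        = ∑ i ∈ (s : Finset (Fin n)), A i j • f i := fun s => by
    rw [columnCombination_apply]
    exact Finset.sum_coe_sort (s : Finset (Fin n)) fun i => A i j • f i
  simp_rw [h1]
  rw [Finset.sum_coe_sort P.parts fun S => ∑ i ∈ S, A i j • f i]
  have h2 : P.parts.biUnion (fun S => S) = Finset.univ := by
    rw [← Finset.sup_eq_biUnion]; exact P.sup_parts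
  refine Eq.trans (Finset.sum_biUnion (t := fun S => S) ?_).symm
    (Finset.sum_congr h2 fun _ _ => rfl)
  intro S hS S' hS' hne
  exact P.disjoint hS hS' hne

theorem prob_forall_combination_eq_prod [MeasurableSpace G] [DiscreteMeasurableSpace G]
    {M : Ω → Matrix (Fin n) (Fin m) (ZMod a)} (f : Fin n → G)
    (P : Finpartition (Finset.univ : Finset (Fin n)))
    (Q : Finpartition (Finset.univ : Finset (Fin m)))
    (hm : ∀ b : P.parts × Q.parts, Measurable fun ω =>
      columnCombination (fun i : (b.1 : Finset (Fin n)) => f i) (matrixBlock (M ω) b.1 b.2))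
    (hind : iIndepFun (fun (b : P.parts × Q.parts) ω =>
      columnCombination (fun i : (b.1 : Finset (Fin n)) => f i) (matrixBlock (M ω) b.1 b.2)) μ) :
    μ.real {ω | ∀ j, ∑ i, M ω i j • f i = 0}
      = ∏ T : Q.parts, μ.real {ω | ∑ s : P.parts,
        columnCombination (fun i : (s : Finset (Fin n)) => f i) (matrixBlock (M ω) s T) = 0} := by
  rw [← iIndep.prob_biInter_groups (fun b => (hm b).comap_le) hind.iIndep Prod.snd
    (fun T => {ω | ∑ s : P.parts,
        columnCombination (fun i : (s : Finset (Fin n)) => f i) (matrixBlock (M ω) s T) = 0})]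
  · congr 1
    ext ω
    simp only [Set.mem_ofPred_eq, Finset.mem_univ, Set.iInter_true, Set.mem_iInter]
    constructor
    · intro h T
      ext j
      rw [sum_parts_columnCombination]
      exact h j
    · intro h j
      obtain ⟨T, hT, hjT⟩ := Q.exists_mem (Finset.mem_univ j)
      have := congrFun (h ⟨T, hT⟩) ⟨j, hjT⟩
      rwa [sum_parts_columnCombination] at this
  · intro T
    have hmT : ∀ s : P.parts, Measurable[⨆ i ∈ {i : P.parts × Q.parts | i.2 = T},
        MeasurableSpace.comap (fun ω => columnCombination (fun i' : (i.1 : Finset (Fin n)) => f i')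
          (matrixBlock (M ω) i.1 i.2)) inferInstance] fun ω =>
        columnCombination (fun i : (s : Finset (Fin n)) => f i) (matrixBlock (M ω) s T) := by
      intro s
      refine Measurable.mono (comap_measurable _) ?_ le_rfl
      exact le_biSup (fun i : P.parts × Q.parts =>
        MeasurableSpace.comap (fun ω => columnCombination (fun i' : (i.1 : Finset (Fin n)) => f i')
          (matrixBlock (M ω) i.1 i.2)) inferInstance)
        (show (s, T) ∈ {i : P.parts × Q.parts | i.2 = T} from rfl)
    have hsum := Finset.measurable_sum Finset.univ fun s _ => hmT s
    exact hsum (measurableSet_singleton 0)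

theorem measurable_columnCombination [MeasurableSpace G] [DiscreteMeasurableSpace G]
    {I J : Type*} [Fintype I] (g : I → G) :
    @Measurable (Matrix I J (ZMod a)) (J → G) MeasurableSpace.pi _ (columnCombination g) := by
  change @Measurable (I → J → ZMod a) (J → G) _ _ fun A j => ∑ i, A i j • g i
  refine measurable_pi_iff.2 fun j => ?_
  refine Finset.measurable_sum _ fun i _ => ?_
  have h1 : Measurable fun A : I → J → ZMod a => A i j := by fun_prop
  exact Measurable.comp (g := fun r : ZMod a => r • g i) measurable_from_top h1

end BalancedMatrix

theorem Finpartition.sum_card_parts_univ {m : ℕ}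
    (Q : Finpartition (Finset.univ : Finset (Fin m))) :
    ∑ T : Q.parts, Fintype.card (T : Finset (Fin m)) = m := by
  have h := Q.sum_card_parts
  rw [Finset.card_univ, Fintype.card_fin] at h
  rw [← Finset.sum_coe_sort] at h
  simpa using h

theorem Finpartition.card_parts_le_univ {m : ℕ}
    (Q : Finpartition (Finset.univ : Finset (Fin m))) : Fintype.card Q.parts ≤ m := by
  simpa using Q.card_parts_le_card

/-- This counts the factors 1 - ε available to a tuple that is not a code. -/
theorem Finpartition.div_le_card_parts {m : ℕ}
    (Q : Finpartition (Finset.univ : Finset (Fin m))) {w : ℝ} (hw : 0 < w)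
    (hQ : ∀ T ∈ Q.parts, (T.card : ℝ) ≤ w) : (m : ℝ) / w ≤ Fintype.card Q.parts := by
  rw [div_le_iff₀ hw]
  have h := Q.sum_card_parts_univ
  calc (m : ℝ) = ∑ T : Q.parts, (Fintype.card (T : Finset (Fin m)) : ℝ) := by
        exact_mod_cast h.symm
    _ ≤ ∑ T : Q.parts, w := Finset.sum_le_sum fun T _ => by simpa using hQ T T.2
    _ = _ := by simp

theorem setOf_exists_parts_eq_range {n : ℕ} {G : Type*}
    {P : Finpartition (Finset.univ : Finset (Fin n))} (f : Fin n → G) :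
    {x | ∃ s : P.parts, ∃ i : (s : Finset (Fin n)), f i = x} = Set.range f := by
  ext x
  constructor
  · rintro ⟨s, i, rfl⟩; exact ⟨i, rfl⟩
  · rintro ⟨i, rfl⟩
    obtain ⟨S, hS, hiS⟩ := P.exists_mem (Finset.mem_univ i)
    exact ⟨⟨S, hS⟩, ⟨i, hiS⟩, rfl⟩

/-! ### The probability that fM = 0 for a single tuple f. -/

section FixedSize

variable {Ω : Type*} [MeasurableSpace Ω] {μ : Measure Ω} [IsProbabilityMeasure μ] {n m a : ℕ}
  {G : Type*} [AddCommGroup G] [Module (ZMod a) G] [Finite G] [MeasurableSpace G]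
  [DiscreteMeasurableSpace G] {M : Ω → Matrix (Fin n) (Fin m) (ZMod a)}
  {P : Finpartition (Finset.univ : Finset (Fin n))}
  {Q : Finpartition (Finset.univ : Finset (Fin m))} {w ε c : ℝ} {e k : ℕ}

/-- Each column block gives a factor 1 + x with |x| ≤ |G|^w exp(-cεk/2), and there are at most m of
them; |∏(1 + x) - 1| ≤ exp(∑|x|) - 1 concludes. -/
theorem abs_card_pow_mul_prob_sub_one_le (he : 0 < e) (heG : ∀ x : G, e • x = 0) (hc0 : 0 < c)
    (hc : ∀ z : ℂ, z ^ e = 1 → z ≠ 1 → z.re ≤ 1 - c) (hε : 0 ≤ ε)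
    (hQ : ∀ T ∈ Q.parts, (T.card : ℝ) ≤ w)
    (hbal : ∀ S ∈ P.parts, ∀ T ∈ Q.parts, IsEpsBalanced μ (fun ω => matrixBlock (M ω) S T) ε)
    (f : Fin n → G)
    (hm : ∀ b : P.parts × Q.parts, Measurable fun ω =>
      columnCombination (fun i : (b.1 : Finset (Fin n)) => f i) (matrixBlock (M ω) b.1 b.2))
    (hind : iIndepFun (fun (b : P.parts × Q.parts) ω =>
      columnCombination (fun i : (b.1 : Finset (Fin n)) => f i) (matrixBlock (M ω) b.1 b.2)) μ)
    (hk : ∀ τ : Finset P.parts, τ.card < k →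
      Submodule.span (ZMod a) {x | ∃ s ∉ τ, ∃ i : (s : Finset (Fin n)), f i = x} = ⊤) :
    |(Nat.card G : ℝ) ^ m * μ.real {ω | ∀ j, ∑ i, M ω i j • f i = 0} - 1|
      ≤ Real.exp (m * ((Nat.card G : ℝ) ^ w * Real.exp (-(c / 2 * ε * k)))) - 1 := by
  classical
  have hN1 : (1 : ℝ) ≤ Nat.card G := by exact_mod_cast Nat.card_pos
  set p : Q.parts → ℝ := fun T => μ.real {ω | ∑ s : P.parts,
    columnCombination (fun i : (s : Finset (Fin n)) => f i) (matrixBlock (M ω) s T) = 0} with hp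
  set E : ℝ := Real.exp (-(c / 2 * ε * k)) with hE
  have hE0 : 0 < E := Real.exp_pos _
  have hpT : ∀ T : Q.parts, |p T - ((Nat.card G : ℝ) ^ Fintype.card (T : Finset (Fin m)))⁻¹| ≤ E :=
    fun T => abs_prob_sum_columnCombination_sub_le he heG hc0 hc hε
      (fun (s : P.parts) ω => matrixBlock (M ω) s T) (fun s => hbal s s.2 T T.2)
      (fun (s : P.parts) (i : (s : Finset (Fin n))) => f i) (fun s => hm (s, T))
      (hind.precomp (g := fun s : P.parts => (s, T)) fun s s' h => congrArg Prod.fst h) k hk 0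
  have hT : ∀ T : Q.parts,
      |(Nat.card G : ℝ) ^ Fintype.card (T : Finset (Fin m)) * p T - 1|
        ≤ (Nat.card G : ℝ) ^ w * E := by
    intro T
    have hpos : 0 < (Nat.card G : ℝ) ^ Fintype.card (T : Finset (Fin m)) := by positivity
    have h1 : (Nat.card G : ℝ) ^ Fintype.card (T : Finset (Fin m)) * p T - 1
        = (Nat.card G : ℝ) ^ Fintype.card (T : Finset (Fin m))
          * (p T - ((Nat.card G : ℝ) ^ Fintype.card (T : Finset (Fin m)))⁻¹) := by
      field_simp
    rw [h1, abs_mul, abs_of_pos hpos]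
    refine mul_le_mul ?_ (hpT T) (abs_nonneg _) (by positivity)
    rw [← Real.rpow_natCast]
    exact Real.rpow_le_rpow_of_exponent_le hN1 (by simpa using hQ T T.2)
  have hprod : (Nat.card G : ℝ) ^ m * μ.real {ω | ∀ j, ∑ i, M ω i j • f i = 0}
      = ∏ T : Q.parts,
        (1 + ((Nat.card G : ℝ) ^ Fintype.card (T : Finset (Fin m)) * p T - 1)) := by
    rw [prob_forall_combination_eq_prod f P Q hm hind]
    simp_rw [add_sub_cancel]
    rw [Finset.prod_mul_distrib, Finset.prod_pow_eq_pow_sum, Q.sum_card_parts_univ]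
  rw [hprod, ← Real.norm_eq_abs]
  refine (Finset.norm_prod_one_add_sub_one_le _ _).trans ?_
  refine sub_le_sub_right (Real.exp_le_exp.2 ?_) 1
  calc ∑ T : Q.parts, ‖(Nat.card G : ℝ) ^ Fintype.card (T : Finset (Fin m)) * p T - 1‖
      ≤ ∑ T : Q.parts, (Nat.card G : ℝ) ^ w * E := Finset.sum_le_sum fun T _ => hT T
    _ = Fintype.card Q.parts * ((Nat.card G : ℝ) ^ w * E) := by simp
    _ ≤ _ := by
        gcongr
        exact Q.card_parts_le_univ

/-- Each column block contributes a factor 1 - ε ≤ exp(-ε) and near-uniformity in H. The saving uses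
the lower bound m / w on the number of column blocks, the error the upper bound m. -/
theorem prob_le_of_robust_span (he : 0 < e) (heG : ∀ x : G, e • x = 0) (hc0 : 0 < c)
    (hc : ∀ z : ℂ, z ^ e = 1 → z ≠ 1 → z.re ≤ 1 - c) (hε : 0 ≤ ε) (hw : 0 < w)
    (hQ : ∀ T ∈ Q.parts, (T.card : ℝ) ≤ w)
    (hbal : ∀ S ∈ P.parts, ∀ T ∈ Q.parts, IsEpsBalanced μ (fun ω => matrixBlock (M ω) S T) ε)
    (f : Fin n → G)
    (hm : ∀ b : P.parts × Q.parts, Measurable fun ω =>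
      columnCombination (fun i : (b.1 : Finset (Fin n)) => f i) (matrixBlock (M ω) b.1 b.2))
    (hind : iIndepFun (fun (b : P.parts × Q.parts) ω =>
      columnCombination (fun i : (b.1 : Finset (Fin n)) => f i) (matrixBlock (M ω) b.1 b.2)) μ)
    (hf : Submodule.span (ZMod a) (Set.range f) = ⊤) {H : Submodule (ZMod a) G} (hH : H ≠ ⊤)
    {σ : Finset P.parts} (hσ : ∀ s ∉ σ, ∀ i : (s : Finset (Fin n)), f i ∈ H)
    (hk : ∀ τ : Finset P.parts, τ.card < k →
      Submodule.span (ZMod a) {x | ∃ s ∉ σ ∪ τ, ∃ i : (s : Finset (Fin n)), f i = x} = H) :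
    μ.real {ω | ∀ j, ∑ i, M ω i j • f i = 0} ≤ ((Nat.card H : ℝ) ^ m)⁻¹ *
      (Real.exp (-(ε * (m / w)))
        * Real.exp (m * ((Nat.card G : ℝ) ^ w * Real.exp (-(c / 2 * ε * k))))) := by
  classical
  have hN1 : (1 : ℝ) ≤ Nat.card G := by exact_mod_cast Nat.card_pos
  have hH1 : (1 : ℝ) ≤ Nat.card H := by exact_mod_cast Nat.card_pos
  have hHN : (Nat.card H : ℝ) ≤ Nat.card G := by
    exact_mod_cast Nat.card_le_card_of_injective _ Subtype.val_injective
  set E : ℝ := Real.exp (-(c / 2 * ε * k)) with hE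
  have hE0 : 0 < E := Real.exp_pos _
  -- Since f spans G and H is proper, some entry leaves H.
  have hout : ∃ (s : P.parts) (i : (s : Finset (Fin n))), f i ∉ H := by
    by_contra! h
    apply hH
    rw [eq_top_iff, ← hf, Submodule.span_le, ← setOf_exists_parts_eq_range (P := P)]
    rintro x ⟨s, i, rfl⟩
    exact h s i
  rw [prob_forall_combination_eq_prod f P Q hm hind]
  have hT : ∀ T : Q.parts, μ.real {ω | ∑ s : P.parts,
      columnCombination (fun i : (s : Finset (Fin n)) => f i) (matrixBlock (M ω) s T) = 0}
      ≤ ((Nat.card H : ℝ) ^ Fintype.card (T : Finset (Fin m)))⁻¹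
        * (Real.exp (-ε) * Real.exp ((Nat.card G : ℝ) ^ w * E)) := by
    intro T
    have hne : Nonempty (T : Finset (Fin m)) := (Q.nonempty_of_mem_parts T.2).to_subtype
    refine (prob_sum_columnCombination_eq_zero_le he heG hc0 hc hε
      (fun (s : P.parts) ω => matrixBlock (M ω) s T) (fun s => hbal s s.2 T T.2)
      (fun (s : P.parts) (i : (s : Finset (Fin n))) => f i) (fun s => hm (s, T))
      (hind.precomp (g := fun s : P.parts => (s, T)) fun s s' h => congrArg Prod.fst h) k H σ hσ
      hout hk).trans ?_
    have hpos : 0 < (Nat.card H : ℝ) ^ Fintype.card (T : Finset (Fin m)) := by positivity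
    have h1 : ((Nat.card H : ℝ) ^ Fintype.card (T : Finset (Fin m)))⁻¹ + E
        = ((Nat.card H : ℝ) ^ Fintype.card (T : Finset (Fin m)))⁻¹
          * (1 + (Nat.card H : ℝ) ^ Fintype.card (T : Finset (Fin m)) * E) := by
      field_simp
    have h2 : (Nat.card H : ℝ) ^ Fintype.card (T : Finset (Fin m)) ≤ (Nat.card G : ℝ) ^ w := by
      refine (pow_le_pow_left₀ (by positivity) hHN _).trans ?_
      rw [← Real.rpow_natCast]
      exact Real.rpow_le_rpow_of_exponent_le hN1 (by simpa using hQ T T.2)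
    have h3 : 1 + (Nat.card H : ℝ) ^ Fintype.card (T : Finset (Fin m)) * E
        ≤ Real.exp ((Nat.card G : ℝ) ^ w * E) := by
      have := Real.add_one_le_exp ((Nat.card G : ℝ) ^ w * E)
      have := mul_le_mul_of_nonneg_right h2 hE0.le
      linarith
    have h4 : 1 - ε ≤ Real.exp (-ε) := by linarith [Real.add_one_le_exp (-ε)]
    rw [h1, mul_left_comm]
    refine mul_le_mul_of_nonneg_left ?_ (inv_pos.2 hpos).le
    exact mul_le_mul h4 h3 (by positivity) (Real.exp_pos _).le
  refine (Finset.prod_le_prod (fun T _ => measureReal_nonneg) fun T _ => hT T).trans ?_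
  rw [Finset.prod_mul_distrib, Finset.prod_inv_distrib, Finset.prod_pow_eq_pow_sum,
    Q.sum_card_parts_univ, Finset.prod_const, mul_pow, ← Real.exp_nat_mul, ← Real.exp_nat_mul,
    Finset.card_univ]
  have hq := Q.div_le_card_parts hw hQ
  have hq' : (Fintype.card Q.parts : ℝ) ≤ m := by exact_mod_cast Q.card_parts_le_univ
  gcongr
  nlinarith

end FixedSize

/-- The factor |H|^(-n) cancels the count of tuples mostly in H, leaving only the overhead of
choosing σ and the values on it. It serves both the probabilities and the uniform weights of tuples
that are not codes. -/
theorem sum_le_of_exists_submodule {n a : ℕ} {G : Type*} [AddCommGroup G] [Module (ZMod a) G]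
    [Fintype G] {P : Finpartition (Finset.univ : Finset (Fin n))} {h : ℕ}
    (hP : ∀ S ∈ P.parts, S.card ≤ h) (l : ℕ)
    (A : Finset (Fin n → G)) (p : (Fin n → G) → ℝ) {b : ℝ} (hb : 0 ≤ b)
    (hA : ∀ f ∈ A, ∃ H : Submodule (ZMod a) G, (∃ σ : Finset P.parts, σ.card ≤ l ∧
      ∀ s ∉ σ, ∀ i : (s : Finset (Fin n)), f i ∈ H) ∧ p f ≤ b * ((Nat.card H : ℝ) ^ n)⁻¹) :
    ∑ f ∈ A, p f ≤ Nat.card (Submodule (ZMod a) G)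
      * (((n : ℝ) + 1) ^ l * (Nat.card G : ℝ) ^ (l * h)) * b := by
  classical
  have := Fintype.ofFinite (Submodule (ZMod a) G)
  let good : Submodule (ZMod a) G → (Fin n → G) → Prop := fun H f =>
    ∃ σ : Finset P.parts, σ.card ≤ l ∧ ∀ s ∉ σ, ∀ i : (s : Finset (Fin n)), f i ∈ H
  have hbH : ∀ H : Submodule (ZMod a) G, 0 ≤ b * ((Nat.card H : ℝ) ^ n)⁻¹ := fun H => by positivity
  calc ∑ f ∈ A, p f
      ≤ ∑ f ∈ A, ∑ H : Submodule (ZMod a) G,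
          if good H f then b * ((Nat.card H : ℝ) ^ n)⁻¹ else 0 := by
        refine Finset.sum_le_sum fun f hf => ?_
        obtain ⟨H, hH, hpH⟩ := hA f hf
        refine hpH.trans ?_
        have h1 := Finset.single_le_sum (s := Finset.univ)
          (f := fun H : Submodule (ZMod a) G =>
            if good H f then b * ((Nat.card H : ℝ) ^ n)⁻¹ else 0)
          (fun H _ => by split_ifs; exacts [hbH H, le_rfl]) (Finset.mem_univ H)
        simpa only [show good H f from hH, if_true] using h1
    _ ≤ ∑ f, ∑ H : Submodule (ZMod a) G,
          if good H f then b * ((Nat.card H : ℝ) ^ n)⁻¹ else 0 :=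
        Finset.sum_le_sum_of_subset_of_nonneg (Finset.subset_univ _) fun f _ _ =>
          Finset.sum_nonneg fun H _ => by split_ifs; exacts [hbH H, le_rfl]
    _ = ∑ H : Submodule (ZMod a) G,
          (Finset.univ.filter (good H)).card * (b * ((Nat.card H : ℝ) ^ n)⁻¹) := by
        rw [Finset.sum_comm]
        refine Finset.sum_congr rfl fun H _ => ?_
        rw [← Finset.sum_filter, Finset.sum_const, nsmul_eq_mul]
    _ ≤ ∑ H : Submodule (ZMod a) G, (((n : ℝ) + 1) ^ l * (Nat.card G : ℝ) ^ (l * h)) * b := by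
        refine Finset.sum_le_sum fun H _ => ?_
        have h1 : ((Finset.univ.filter (good H)).card : ℝ)
            ≤ ((n : ℝ) + 1) ^ l * (Nat.card G : ℝ) ^ (l * h) * (Nat.card H : ℝ) ^ n := by
          exact_mod_cast card_exists_pi_mem_le P hP H l
        have hpos : 0 < (Nat.card H : ℝ) ^ n := by
          have : 0 < Nat.card H := Nat.card_pos
          positivity
        refine (mul_le_mul_of_nonneg_right h1 (hbH H)).trans (le_of_eq ?_)
        field_simp
    _ = _ := by
        rw [Finset.sum_const, Finset.card_univ, nsmul_eq_mul, ← Nat.card_eq_fintype_card,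
          ← mul_assoc]

/-! ### The expectation as a sum over tuples, with an explicit error bound. -/

section Moment

variable {Ω : Type*} [MeasurableSpace Ω] {μ : Measure Ω} [IsProbabilityMeasure μ] {n m a : ℕ}
  {G : Type*} [AddCommGroup G] [Module (ZMod a) G] {M : Ω → Matrix (Fin n) (Fin m) (ZMod a)}

theorem measurableSet_forall_combination_eq_zero [Finite G]
    (hM : ∀ i j, Measurable fun ω => M ω i j) (f : Fin n → G) :
    MeasurableSet {ω | ∀ j, ∑ i, M ω i j • f i = 0} := by
  let _ : MeasurableSpace G := ⊤
  have : DiscreteMeasurableSpace G := ⟨fun _ => trivial⟩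
  rw [Set.ofPred_forall]
  refine MeasurableSet.iInter fun j => ?_
  have h : Measurable fun ω => ∑ i, M ω i j • f i := Finset.measurable_sum _ fun i _ =>
    Measurable.comp (g := fun r : ZMod a => r • f i) measurable_from_top (hM i j)
  exact h (measurableSet_singleton 0)

open Classical in
theorem numSur_matrixCoker_eq_sum {Ω : Type*} {n m a : ℕ} {G : Type*} [AddCommGroup G]
    [Module (ZMod a) G] [Fintype G] (M : Ω → Matrix (Fin n) (Fin m) (ZMod a)) (ω : Ω) :
    (numSur (matrixCoker (M ω)) G : ℝ)
      = ∑ f : Fin n → G with Submodule.span (ZMod a) (Set.range f) = ⊤,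
        Set.indicator {ω | ∀ j, ∑ i, M ω i j • f i = 0} (fun _ => (1 : ℝ)) ω := by
  rw [numSur_matrixCoker, Nat.card_eq_fintype_card, Fintype.card_subtype]
  simp only [Set.indicator_apply, Set.mem_ofPred_eq]
  rw [Finset.sum_boole, Finset.filter_filter]

theorem integrable_numSur [Finite G] (hM : ∀ i j, Measurable fun ω => M ω i j) :
    Integrable (fun ω => (numSur (matrixCoker (M ω)) G : ℝ)) μ := by
  have := Fintype.ofFinite G
  simp_rw [numSur_matrixCoker_eq_sum]
  exact integrable_finsetSum _ fun f _ =>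
    (integrable_const 1).indicator (measurableSet_forall_combination_eq_zero hM f)

open Classical in
theorem integral_numSur [Fintype G] (hM : ∀ i j, Measurable fun ω => M ω i j) :
    ∫ ω, (numSur (matrixCoker (M ω)) G : ℝ) ∂μ
      = ∑ f : Fin n → G with Submodule.span (ZMod a) (Set.range f) = ⊤,
        μ.real {ω | ∀ j, ∑ i, M ω i j • f i = 0} := by
  simp_rw [numSur_matrixCoker_eq_sum]
  rw [integral_finsetSum _ fun f _ =>
    (integrable_const 1).indicator (measurableSet_forall_combination_eq_zero hM f)]
  refine Finset.sum_congr rfl fun f _ => ?_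
  rw [integral_indicator_const _ (measurableSet_forall_combination_eq_zero hM f)]
  simp

/-- A quantitative form of the moment asymptotics for a matrix of fixed size. -/
theorem abs_integral_numSur_sub_le {u e k h : ℕ} [Finite G]
    {M : Ω → Matrix (Fin n) (Fin (n + u)) (ZMod a)} {w ε c : ℝ}
    (hMm : ∀ i j, Measurable fun ω => M ω i j) (hM : IsBalancedMatrix μ M w h ε)
    (he : 0 < e) (heG : ∀ x : G, e • x = 0) (hc0 : 0 < c)
    (hc : ∀ z : ℂ, z ^ e = 1 → z ≠ 1 → z.re ≤ 1 - c) (hε : 0 ≤ ε) (hw : 0 < w) (hk : 0 < k) :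
    |∫ ω, (numSur (matrixCoker (M ω)) G : ℝ) ∂μ - (Nat.card G : ℝ) ^ (-(u : ℤ))|
      ≤ (Real.exp ((n + u : ℕ) * ((Nat.card G : ℝ) ^ w * Real.exp (-(c / 2 * ε * k)))) - 1)
        + Nat.card (Submodule (ZMod a) G) * (((n : ℝ) + 1) ^ (k * Nat.card G)
            * (Nat.card G : ℝ) ^ (k * Nat.card G * h))
          * ((2 ^ n)⁻¹ + Real.exp (-(ε * ((n + u : ℕ) / w)))
            * Real.exp ((n + u : ℕ) * ((Nat.card G : ℝ) ^ w * Real.exp (-(c / 2 * ε * k))))) := by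
  classical
  let _ : MeasurableSpace G := ⊤
  have : DiscreteMeasurableSpace G := ⟨fun _ => trivial⟩
  have := Fintype.ofFinite G
  obtain ⟨P, Q, hP, hQ, hbal, hind₀⟩ := hM
  have hPn : ∀ S ∈ P.parts, S.card ≤ h := fun S hS => by exact_mod_cast hP S hS
  have hm : ∀ (f : Fin n → G) (b : P.parts × Q.parts), Measurable fun ω =>
      columnCombination (fun i : (b.1 : Finset (Fin n)) => f i)
        (matrixBlock (M ω) b.1 b.2) := by
    intro f b
    refine Measurable.comp (measurable_columnCombination _) ?_
    exact measurable_pi_iff.2 fun i => measurable_pi_iff.2 fun j => hMm i j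
  have hind : ∀ f : Fin n → G, iIndepFun (fun (b : P.parts × Q.parts) ω =>
      columnCombination (fun i : (b.1 : Finset (Fin n)) => f i)
        (matrixBlock (M ω) b.1 b.2)) μ := fun f =>
    hind₀.comp (fun b => columnCombination (fun i : (b.1 : Finset (Fin n)) => f i))
      fun b => measurable_columnCombination _
  set p : (Fin n → G) → ℝ := fun f => μ.real {ω | ∀ j, ∑ i, M ω i j • f i = 0} with hp
  set N : ℝ := (Nat.card G : ℝ) with hN
  have hN1 : 1 ≤ N := by rw [hN]; exact_mod_cast Nat.card_pos
  have hN0 : 0 < N := by linarith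
  set D : ℝ := (n + u : ℕ) * (N ^ w * Real.exp (-(c / 2 * ε * k))) with hD
  set l : ℕ := k * Nat.card G with hl
  set sur : Finset (Fin n → G) :=
    Finset.univ.filter fun f => Submodule.span (ZMod a) (Set.range f) = ⊤ with hsur
  set code : Finset (Fin n → G) := Finset.univ.filter fun f => ∀ τ : Finset P.parts, τ.card < k →
    Submodule.span (ZMod a) {x | ∃ s ∉ τ, ∃ i : (s : Finset (Fin n)), f i = x} = ⊤ with hcode
  have hsub : code ⊆ sur := by
    intro f hf
    rw [hcode, Finset.mem_filter] at hf
    rw [hsur, Finset.mem_filter]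
    have h1 := hf.2 ∅ (by simpa using hk)
    refine ⟨Finset.mem_univ _, ?_⟩
    rw [← setOf_exists_parts_eq_range (P := P)]
    simpa using h1
  have hdich : ∀ f ∉ code, ∃ H : Submodule (ZMod a) G, H ≠ ⊤ ∧ ∃ σ : Finset P.parts,
      σ.card ≤ l ∧ (∀ s ∉ σ, ∀ i : (s : Finset (Fin n)), f i ∈ H) ∧
      ∀ τ : Finset P.parts, τ.card < k →
        Submodule.span (ZMod a) {x | ∃ s ∉ σ ∪ τ, ∃ i : (s : Finset (Fin n)), f i = x} = H := by
    intro f hf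
    refine (exists_robust_span (R := ZMod a)
      (fun (s : P.parts) (i : (s : Finset (Fin n))) => f i) k).resolve_left fun h => hf ?_
    rw [hcode, Finset.mem_filter]
    exact ⟨Finset.mem_univ _, h⟩
  have hH0 : ∀ H : Submodule (ZMod a) G, 0 < (Nat.card H : ℝ) := fun H => by
    exact_mod_cast Nat.card_pos
  have hH1 : ∀ H : Submodule (ZMod a) G, 1 ≤ (Nat.card H : ℝ) := fun H => by
    exact_mod_cast Nat.card_pos
  -- A proper subgroup has index at least 2; this is the source of the error term 2^(-n).
  have hH2 : ∀ H : Submodule (ZMod a) G, H ≠ ⊤ → 2 * (Nat.card H : ℝ) ≤ N := by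
    intro H hH
    have hdvd : Nat.card H ∣ Nat.card G := H.toAddSubgroup.card_addSubgroup_dvd_card
    obtain ⟨q, hq⟩ := hdvd
    have hG0 : 0 < Nat.card G := Nat.card_pos
    have hq2 : 2 ≤ q := by
      by_contra! hlt
      interval_cases q
      · omega
      · apply hH
        have : H.toAddSubgroup = ⊤ := AddSubgroup.eq_top_of_card_eq _ (by simpa using hq.symm)
        exact Submodule.toAddSubgroup_injective this
    have : 2 * Nat.card H ≤ Nat.card G := by rw [hq, mul_comm]; exact Nat.mul_le_mul_left _ hq2
    rw [hN]
    exact_mod_cast this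
  have hpow : N ^ n * (N ^ (n + u))⁻¹ = (N ^ u)⁻¹ := by
    rw [pow_add]; field_simp
  have hpowle : (N ^ u)⁻¹ ≤ 1 := inv_le_one_of_one_le₀ (one_le_pow₀ hN1)
  -- The main term |G|^(-u) is the uniform weight of all tuples, spanning or not, so the weight of
  -- every tuple that is not a code has to be discarded.
  have hnoncode : ∑ f ∈ codeᶜ, (N ^ (n + u))⁻¹ ≤ Nat.card (Submodule (ZMod a) G)
      * (((n : ℝ) + 1) ^ l * N ^ (l * h)) * (2 ^ n)⁻¹ := by
    refine sum_le_of_exists_submodule hPn l codeᶜ (fun _ => (N ^ (n + u))⁻¹) (by positivity) ?_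
    intro f hf
    obtain ⟨H, hH, σ, hσ, hσH, -⟩ := hdich f (Finset.mem_compl.1 hf)
    refine ⟨H, ⟨σ, hσ, hσH⟩, ?_⟩
    rw [← mul_inv, ← mul_pow]
    have := hH0 H
    refine inv_anti₀ (by positivity) ?_
    exact (pow_le_pow_left₀ (by positivity) (hH2 H hH) n).trans
      (pow_le_pow_right₀ hN1 (Nat.le_add_right n u))
  have hrest : ∑ f ∈ sur \ code, p f ≤ Nat.card (Submodule (ZMod a) G)
      * (((n : ℝ) + 1) ^ l * N ^ (l * h))
      * (Real.exp (-(ε * ((n + u : ℕ) / w))) * Real.exp D) := by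
    refine sum_le_of_exists_submodule hPn l (sur \ code) p (by positivity) ?_
    intro f hf
    rw [Finset.mem_sdiff, hsur, Finset.mem_filter] at hf
    obtain ⟨H, hH, σ, hσ, hσH, hσk⟩ := hdich f hf.2
    refine ⟨H, ⟨σ, hσ, hσH⟩, ?_⟩
    refine (prob_le_of_robust_span he heG hc0 hc hε hw hQ hbal f (hm f) (hind f) hf.1.2 hH hσH
      hσk).trans ?_
    rw [mul_comm]
    refine mul_le_mul_of_nonneg_left ?_ (by positivity)
    have := hH0 H
    exact inv_anti₀ (by positivity) (pow_le_pow_right₀ (hH1 H) (Nat.le_add_right n u))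
  have hcodesum : |∑ f ∈ code, (p f - (N ^ (n + u))⁻¹)| ≤ Real.exp D - 1 := by
    have hD0 : 0 ≤ Real.exp D - 1 := by
      have : 0 ≤ D := by positivity
      linarith [Real.add_one_le_exp D]
    have h1 : ∀ f ∈ code, |p f - (N ^ (n + u))⁻¹| ≤ (N ^ (n + u))⁻¹ * (Real.exp D - 1) := by
      intro f hf
      rw [hcode, Finset.mem_filter] at hf
      have h2 := abs_card_pow_mul_prob_sub_one_le he heG hc0 hc hε hQ hbal f (hm f) (hind f) hf.2
      have h3 : p f - (N ^ (n + u))⁻¹ = (N ^ (n + u))⁻¹ * (N ^ (n + u) * p f - 1) := by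
        field_simp
      rw [h3, abs_mul, abs_of_pos (by positivity : 0 < (N ^ (n + u))⁻¹)]
      exact mul_le_mul_of_nonneg_left h2 (by positivity)
    refine (Finset.abs_sum_le_sum_abs _ _).trans ((Finset.sum_le_sum h1).trans ?_)
    rw [Finset.sum_const, nsmul_eq_mul, ← mul_assoc]
    refine mul_le_of_le_one_left hD0 (le_trans ?_ hpowle)
    rw [← hpow]
    refine mul_le_mul_of_nonneg_right ?_ (by positivity)
    have h2 : code.card ≤ Nat.card G ^ n := by
      refine (Finset.card_le_univ code).trans (le_of_eq ?_)
      rw [← Nat.card_eq_fintype_card, Nat.card_fun]; simp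
    rw [hN]
    exact_mod_cast h2
  have htotal : ∑ f ∈ code, (N ^ (n + u))⁻¹ + ∑ f ∈ codeᶜ, (N ^ (n + u))⁻¹ = (N ^ u)⁻¹ := by
    rw [Finset.sum_add_sum_compl, Finset.sum_const, Finset.card_univ, nsmul_eq_mul,
      ← Nat.card_eq_fintype_card, Nat.card_fun, ← hpow]
    simp [hN]
  have hI : ∫ ω, (numSur (matrixCoker (M ω)) G : ℝ) ∂μ
      = ∑ f ∈ sur \ code, p f + ∑ f ∈ code, p f := by
    rw [Finset.sum_sdiff hsub, integral_numSur hMm]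
  have hrest0 : 0 ≤ ∑ f ∈ sur \ code, p f := Finset.sum_nonneg fun f _ => measureReal_nonneg
  have hnc0 : 0 ≤ ∑ f ∈ codeᶜ, (N ^ (n + u))⁻¹ := Finset.sum_nonneg fun f _ => by positivity
  rw [zpow_neg, zpow_natCast, hI, ← htotal, mul_add]
  rw [Finset.sum_sub_distrib] at hcodesum
  obtain ⟨h1, h2⟩ := abs_le.1 hcodesum
  rw [abs_le]
  constructor <;> linarith

end Moment

/-! ### Growth rates and the vanishing of the error terms. -/

theorem IsBalancedMatrix.mono {Ω : Type*} [MeasurableSpace Ω] {μ : Measure Ω} {m n : ℕ}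
    {R : Type*} [Ring R] [MeasurableSpace R] {M : Ω → Matrix (Fin m) (Fin n) R}
    {w w' h h' ε ε' : ℝ} (hM : IsBalancedMatrix μ M w h ε) (hw : w ≤ w') (hh : h ≤ h')
    (hε : ε' ≤ ε) : IsBalancedMatrix μ M w' h' ε' := by
  obtain ⟨P, Q, hP, hQ, hbal, hind⟩ := hM
  exact ⟨P, Q, fun S hS => (hP S hS).trans hh, fun T hT => (hQ T hT).trans hw,
    fun S hS T hT H hH g => (hbal S hS T hT H hH g).trans (by linarith), hind⟩

theorem tendsto_rpow_add_rpow_sub_atBot {p q θ C₁ C₂ c : ℝ} (hp : p < θ) (hq : q < θ)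
    (hθ : 0 < θ) (hc : 0 < c) :
    Tendsto (fun n : ℕ => C₁ * (n : ℝ) ^ p + C₂ * (n : ℝ) ^ q - c * (n : ℝ) ^ θ) atTop atBot := by
  have hneg : ∀ r, r < θ → Tendsto (fun n : ℕ => (n : ℝ) ^ (r - θ)) atTop (𝓝 0) := by
    intro r hr
    have h := (tendsto_rpow_neg_atTop (y := θ - r) (by linarith)).comp tendsto_natCast_atTop_atTop
    simpa [Function.comp_def] using h
  have h1 : Tendsto (fun n : ℕ => C₁ * (n : ℝ) ^ (p - θ) + C₂ * (n : ℝ) ^ (q - θ) - c) atTop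
      (𝓝 (-c)) := by
    have h := (((hneg p hp).const_mul C₁).add ((hneg q hq).const_mul C₂)).sub_const c
    simpa using h
  have h2 : Tendsto (fun n : ℕ => (n : ℝ) ^ θ) atTop atTop :=
    (tendsto_rpow_atTop hθ).comp tendsto_natCast_atTop_atTop
  refine (h1.neg_mul_atTop (by linarith) h2).congr' ?_
  filter_upwards [eventually_ge_atTop 1] with n hn
  have hn0 : (0 : ℝ) < n := by exact_mod_cast hn
  rw [Real.rpow_sub hn0, Real.rpow_sub hn0]
  have : (0 : ℝ) < (n : ℝ) ^ θ := Real.rpow_pos_of_pos hn0 _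
  field_simp

theorem natCeil_mul_rpow_le {A x r : ℝ} (hA : 1 ≤ A) (hx : 1 ≤ x) (hr : 0 ≤ r) :
    (⌈A * x ^ r⌉₊ : ℝ) ≤ 2 * A * x ^ r := by
  have h1 : 1 ≤ x ^ r := Real.one_le_rpow hx hr
  have h2 : 1 ≤ A * x ^ r := by nlinarith
  have := (Nat.ceil_lt_add_one (by linarith : 0 ≤ A * x ^ r)).le
  linarith

theorem log_le_rpow_of_one_le {x δ : ℝ} (hx : 1 ≤ x) (hδ : 0 < δ) :
    Real.log (x + 1) ≤ 2 ^ δ / δ * x ^ δ := by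
  refine (Real.log_le_rpow_div (by linarith) hδ).trans ?_
  rw [div_mul_eq_mul_div]
  refine div_le_div_of_nonneg_right ?_ hδ.le
  rw [← Real.mul_rpow (by norm_num) (by linarith)]
  exact Real.rpow_le_rpow (by linarith) (by linarith) hδ.le

section ErrorTerms

variable {N A A' B c α₁ α₂ β κ : ℝ} (u : ℕ)

/-- This is D with k = ⌈n^κ⌉: the decay exponent is of order n^(κ-β), which beats both n^α₁ from
|G|^w and the logarithm of the prefactor. -/
theorem tendsto_code_error (hN : 1 ≤ N) (hB : 0 < B) (hc : 0 < c) (hα₁ : 0 ≤ α₁)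
    (hκ : α₁ + β < κ) :
    Tendsto (fun n : ℕ => ((n + u : ℕ) : ℝ) * (N ^ (A * (n : ℝ) ^ α₁)
      * Real.exp (-(c / 2 * (B * (n : ℝ) ^ (-β)) * ⌈1 * (n : ℝ) ^ κ⌉₊)))) atTop (𝓝 0) := by
  set δ : ℝ := (κ - β) / 2 with hδ
  have hδ0 : 0 < δ := by rw [hδ]; linarith
  have hlim : Tendsto (fun n : ℕ => (1 + u : ℝ) * Real.exp (2 ^ δ / δ * (n : ℝ) ^ δ
      + A * Real.log N * (n : ℝ) ^ α₁ - c / 2 * B * (n : ℝ) ^ (κ - β))) atTop (𝓝 0) := by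
    have h := (Real.tendsto_exp_atBot.comp (tendsto_rpow_add_rpow_sub_atBot
      (C₁ := 2 ^ δ / δ) (C₂ := A * Real.log N) (p := δ) (q := α₁) (θ := κ - β) (c := c / 2 * B)
      (by rw [hδ]; linarith) (by linarith) (by linarith) (by positivity))).const_mul (1 + u : ℝ)
    simpa [Function.comp_def] using h
  refine tendsto_of_tendsto_of_tendsto_of_le_of_le' tendsto_const_nhds hlim
    (Eventually.of_forall fun n => by positivity) ?_
  filter_upwards [eventually_ge_atTop 1] with n hn
  have hn1 : (1 : ℝ) ≤ n := by exact_mod_cast hn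
  have hn0 : (0 : ℝ) < n := by linarith
  have h1 : ((n + u : ℕ) : ℝ) ≤ (1 + u) * Real.exp (2 ^ δ / δ * (n : ℝ) ^ δ) := by
    have h2 : ((n + u : ℕ) : ℝ) ≤ (1 + u) * (n : ℝ) := by
      push_cast
      have : (0 : ℝ) ≤ u := Nat.cast_nonneg u
      nlinarith
    refine h2.trans (mul_le_mul_of_nonneg_left ?_ (by positivity))
    calc (n : ℝ) ≤ n + 1 := by linarith
      _ = Real.exp (Real.log (n + 1)) := (Real.exp_log (by linarith)).symm
      _ ≤ _ := Real.exp_le_exp.2 (log_le_rpow_of_one_le hn1 hδ0)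
  have h2 : N ^ (A * (n : ℝ) ^ α₁) = Real.exp (A * Real.log N * (n : ℝ) ^ α₁) := by
    rw [Real.rpow_def_of_pos (by linarith)]; congr 1; ring
  have h3 : Real.exp (-(c / 2 * (B * (n : ℝ) ^ (-β)) * ⌈1 * (n : ℝ) ^ κ⌉₊))
      ≤ Real.exp (-(c / 2 * B * (n : ℝ) ^ (κ - β))) := by
    refine Real.exp_le_exp.2 (neg_le_neg ?_)
    have h4 : (n : ℝ) ^ (κ - β) = (n : ℝ) ^ (-β) * (n : ℝ) ^ κ := by
      rw [← Real.rpow_add hn0]; congr 1; ring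
    have h5 : (n : ℝ) ^ κ ≤ ⌈1 * (n : ℝ) ^ κ⌉₊ := by simpa using Nat.le_ceil (1 * (n : ℝ) ^ κ)
    rw [h4]
    calc c / 2 * B * ((n : ℝ) ^ (-β) * (n : ℝ) ^ κ)
        = c / 2 * (B * (n : ℝ) ^ (-β)) * (n : ℝ) ^ κ := by ring
      _ ≤ _ := mul_le_mul_of_nonneg_left h5 (by positivity)
  rw [h2, sub_eq_add_neg, Real.exp_add, Real.exp_add]
  refine (mul_le_mul h1 (mul_le_mul_of_nonneg_left h3 (Real.exp_pos _).le) (by positivity)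
    (by positivity)).trans (le_of_eq ?_)
  ring

theorem exists_count_le (K : ℕ) (hN : 1 ≤ N) (hA' : 1 ≤ A') (hα₂ : 0 ≤ α₂) (hκ : 0 ≤ κ) {δ : ℝ}
    (hδ : 0 < δ) : ∃ C₁ C₂ : ℝ, ∀ n : ℕ, 1 ≤ n →
      ((n : ℝ) + 1) ^ (⌈1 * (n : ℝ) ^ κ⌉₊ * K)
          * N ^ (⌈1 * (n : ℝ) ^ κ⌉₊ * K * ⌈A' * (n : ℝ) ^ α₂⌉₊)
        ≤ Real.exp (C₁ * (n : ℝ) ^ (κ + δ) + C₂ * (n : ℝ) ^ (κ + α₂)) := by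
  refine ⟨2 * K * (2 ^ δ / δ), 2 * K * (2 * A') * Real.log N, fun n hn => ?_⟩
  have hn1 : (1 : ℝ) ≤ n := by exact_mod_cast hn
  have hn0 : (0 : ℝ) < n := by linarith
  have hlogN : 0 ≤ Real.log N := Real.log_nonneg hN
  have hk : (⌈1 * (n : ℝ) ^ κ⌉₊ : ℝ) ≤ 2 * (n : ℝ) ^ κ := by
    simpa using natCeil_mul_rpow_le (le_refl (1 : ℝ)) hn1 hκ
  have hh : (⌈A' * (n : ℝ) ^ α₂⌉₊ : ℝ) ≤ 2 * A' * (n : ℝ) ^ α₂ :=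
    natCeil_mul_rpow_le hA' hn1 hα₂
  set k := ⌈1 * (n : ℝ) ^ κ⌉₊
  set h := ⌈A' * (n : ℝ) ^ α₂⌉₊
  have e1 : ((n : ℝ) + 1) ^ (k * K) = Real.exp ((k * K : ℕ) * Real.log (n + 1)) := by
    rw [Real.exp_nat_mul, Real.exp_log (by linarith)]
  have e2 : N ^ (k * K * h) = Real.exp ((k * K * h : ℕ) * Real.log N) := by
    rw [Real.exp_nat_mul, Real.exp_log (by linarith)]
  rw [e1, e2, ← Real.exp_add]
  refine Real.exp_le_exp.2 (add_le_add ?_ ?_)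
  · have h1 := log_le_rpow_of_one_le hn1 hδ
    have h0 : 0 ≤ Real.log ((n : ℝ) + 1) := Real.log_nonneg (by linarith)
    rw [Real.rpow_add hn0]
    push_cast
    calc (k : ℝ) * K * Real.log (n + 1)
        ≤ (2 * (n : ℝ) ^ κ) * K * (2 ^ δ / δ * (n : ℝ) ^ δ) := by gcongr
      _ = _ := by ring
  · rw [Real.rpow_add hn0]
    push_cast
    calc (k : ℝ) * K * h * Real.log N
        ≤ (2 * (n : ℝ) ^ κ) * K * (2 * A' * (n : ℝ) ^ α₂) * Real.log N := by gcongr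
      _ = _ := by ring

/-- The logarithm of the count is of order at most n^(κ+δ) + n^(κ+α₂), while the savings have
exponents of order n and n^(1-α₁-β). -/
theorem tendsto_count_mul_zero (K : ℕ) (hN : 1 ≤ N) (hA : 0 < A) (hA' : 1 ≤ A') (hB : 0 < B)
    (hα₁ : 0 ≤ α₁) (hα₂ : 0 ≤ α₂) (hβ : 0 ≤ β) (hκ : 0 ≤ κ) (hκ' : κ < 1 - α₁ - α₂ - β)
    {E : ℕ → ℝ} (hE : Tendsto E atTop (𝓝 0)) :
    Tendsto (fun n : ℕ => (((n : ℝ) + 1) ^ (⌈1 * (n : ℝ) ^ κ⌉₊ * K)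
          * N ^ (⌈1 * (n : ℝ) ^ κ⌉₊ * K * ⌈A' * (n : ℝ) ^ α₂⌉₊))
        * ((2 ^ n)⁻¹ + Real.exp (-(B * (n : ℝ) ^ (-β) * ((n + u : ℕ) / (A * (n : ℝ) ^ α₁))))
          * Real.exp (E n))) atTop (𝓝 0) := by
  set θ : ℝ := 1 - α₁ - β with hθ
  -- The factor log(n+1) is absorbed into n^δ, with δ small enough that κ + δ < θ.
  set δ : ℝ := (θ - κ) / 2 with hδ
  have hδ0 : 0 < δ := by rw [hδ]; linarith
  obtain ⟨C₁, C₂, hC⟩ := exists_count_le (N := N) (A' := A') (α₂ := α₂) (κ := κ) K hN hA' hα₂ hκ hδ0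
  have l1 : Tendsto (fun n : ℕ => Real.exp (C₁ * (n : ℝ) ^ (κ + δ) + C₂ * (n : ℝ) ^ (κ + α₂)
      - Real.log 2 * (n : ℝ) ^ (1 : ℝ))) atTop (𝓝 0) :=
    Real.tendsto_exp_atBot.comp (tendsto_rpow_add_rpow_sub_atBot (by linarith) (by linarith)
      one_pos (Real.log_pos one_lt_two))
  have l2 : Tendsto (fun n : ℕ => Real.exp (C₁ * (n : ℝ) ^ (κ + δ) + C₂ * (n : ℝ) ^ (κ + α₂)
      - B / A * (n : ℝ) ^ θ)) atTop (𝓝 0) :=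
    Real.tendsto_exp_atBot.comp (tendsto_rpow_add_rpow_sub_atBot (by linarith) (by linarith)
      (by linarith) (by positivity))
  have l3 : Tendsto (fun n => Real.exp (E n)) atTop (𝓝 1) := by
    simpa [Function.comp_def] using (Real.continuous_exp.tendsto 0).comp hE
  have hlim := l1.add (l2.mul l3)
  rw [zero_mul, zero_add] at hlim
  refine tendsto_of_tendsto_of_tendsto_of_le_of_le' tendsto_const_nhds hlim
    (Eventually.of_forall fun n => by positivity) ?_
  filter_upwards [eventually_ge_atTop 1] with n hn
  have hn1 : (1 : ℝ) ≤ n := by exact_mod_cast hn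
  have hn0 : (0 : ℝ) < n := by linarith
  have h2 : ((2 : ℝ) ^ n)⁻¹ = Real.exp (-(Real.log 2 * (n : ℝ) ^ (1 : ℝ))) := by
    rw [Real.exp_neg, Real.rpow_one, mul_comm, Real.exp_nat_mul, Real.exp_log two_pos]
  have h3 : Real.exp (-(B * (n : ℝ) ^ (-β) * ((n + u : ℕ) / (A * (n : ℝ) ^ α₁))))
      ≤ Real.exp (-(B / A * (n : ℝ) ^ θ)) := by
    refine Real.exp_le_exp.2 (neg_le_neg ?_)
    have h4 : (n : ℝ) ^ θ = (n : ℝ) ^ (-β) * (n / (n : ℝ) ^ α₁) := by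
      rw [hθ, show 1 - α₁ - β = -β + (1 - α₁) by ring, Real.rpow_add hn0, Real.rpow_sub hn0,
        Real.rpow_one]
    have h5 : (n : ℝ) / (A * (n : ℝ) ^ α₁) ≤ (n + u : ℕ) / (A * (n : ℝ) ^ α₁) := by
      gcongr; omega
    calc B / A * (n : ℝ) ^ θ = B * (n : ℝ) ^ (-β) * (n / (A * (n : ℝ) ^ α₁)) := by
          rw [h4]; field_simp
      _ ≤ _ := mul_le_mul_of_nonneg_left h5 (by positivity)
  calc _ ≤ Real.exp (C₁ * (n : ℝ) ^ (κ + δ) + C₂ * (n : ℝ) ^ (κ + α₂))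
        * (Real.exp (-(Real.log 2 * (n : ℝ) ^ (1 : ℝ)))
          + Real.exp (-(B / A * (n : ℝ) ^ θ)) * Real.exp (E n)) := by
        rw [h2]
        gcongr
        exact hC n hn
    _ = _ := by
        rw [sub_eq_add_neg, sub_eq_add_neg, Real.exp_add _ (-(Real.log 2 * _)),
          Real.exp_add _ (-(B / A * _))]
        ring

end ErrorTerms

/-- The case `a = 0`, in which `ZMod a` is `ℤ`, is included. -/
theorem theorem3p14 (u : ℕ) (G : Type*) [AddCommGroup G] [Finite G] (a : ℕ)
    (ha : AddMonoid.exponent G ∣ a) (w h ε : ℕ → ℝ) (α₁ α₂ β : ℝ)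
    (hα₁ : 0 ≤ α₁) (hα₁' : α₁ < 1) (hα₂ : 0 ≤ α₂) (hα₂' : α₂ < 1) (hβ : 0 ≤ β) (hβ' : β < 1)
    (hαβ : 2 * α₁ + α₂ < 1 - 2 * β)
    (hw : ∃ A : ℝ, ∀ᶠ n : ℕ in atTop, w n ≤ A * (n : ℝ) ^ α₁)
    (hh : ∃ A : ℝ, ∀ᶠ n : ℕ in atTop, h n ≤ A * (n : ℝ) ^ α₂)
    (hε : ∃ B : ℝ, 0 < B ∧ ∀ᶠ n : ℕ in atTop, B * (n : ℝ) ^ (-β) ≤ ε n)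
    (Ω : ℕ → Type*) [∀ n, MeasurableSpace (Ω n)] (μ : ∀ n, Measure (Ω n))
    [∀ n, IsProbabilityMeasure (μ n)]
    (M : ∀ n, Ω n → Matrix (Fin n) (Fin (n + u)) (ZMod a))
    (hM_meas : ∀ n i j, Measurable fun ω => M n ω i j)
    (hM : ∀ n, IsBalancedMatrix (μ n) (M n) (w n) (h n) (ε n)) :
    (∀ n, Integrable (fun ω => (numSur (matrixCoker (M n ω)) G : ℝ)) (μ n)) ∧
      Tendsto (fun n => ∫ ω, (numSur (matrixCoker (M n ω)) G : ℝ) ∂(μ n)) atTop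
        (𝓝 ((Nat.card G : ℝ) ^ (-(u : ℤ)))) := by
  have hexp : ∀ x : G, AddMonoid.exponent G • x = 0 := AddMonoid.exponent_nsmul_eq_zero
  have he : 0 < AddMonoid.exponent G := AddMonoid.exponent_pos_of_exists
    (Nat.card G) Nat.card_pos fun x => card_nsmul_eq_zero'
  let _ : Module (ZMod a) G := AddCommGroup.zmodModule fun x => by
    obtain ⟨b, rfl⟩ := ha
    rw [mul_comm, mul_nsmul', hexp, nsmul_zero]
  refine ⟨fun n => integrable_numSur (hM_meas n), ?_⟩
  obtain ⟨c, hc0, hc⟩ := exists_rootOfUnity_gap he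
  obtain ⟨A₀, hA₀⟩ := hw
  obtain ⟨A₁, hA₁⟩ := hh
  obtain ⟨B, hB, hBε⟩ := hε
  set A : ℝ := max A₀ 1 with hA
  set A' : ℝ := max A₁ 1 with hA'
  have hA1 : 0 < A := lt_of_lt_of_le one_pos (le_max_right _ _)
  have hA'1 : 1 ≤ A' := le_max_right _ _
  have hN1 : (1 : ℝ) ≤ Nat.card G := by exact_mod_cast Nat.card_pos
  -- The midpoint of the interval from α₁ + β to 1 - α₁ - α₂ - β, which is nonempty exactly by
  -- `hαβ`.
  set κ : ℝ := (1 - α₂) / 2 with hκ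
  have hκ1 : α₁ + β < κ := by rw [hκ]; linarith
  have hκ2 : κ < 1 - α₁ - α₂ - β := by rw [hκ]; linarith
  have hκ0 : 0 ≤ κ := by linarith
  have hD := tendsto_code_error (N := Nat.card G) (A := A) (α₁ := α₁) (β := β) (κ := κ) u hN1 hB hc0
    hα₁ hκ1
  have hR := tendsto_count_mul_zero (N := Nat.card G) (α₁ := α₁) (α₂ := α₂) (β := β) (κ := κ) u
    (Nat.card G) hN1 hA1 hA'1 hB hα₁ hα₂ hβ hκ0 hκ2 hD
  have hbound := (((Real.continuous_exp.tendsto 0).comp hD).sub_const 1).add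
    (hR.const_mul (Nat.card (Submodule (ZMod a) G) : ℝ))
  rw [Real.exp_zero, sub_self, mul_zero, add_zero] at hbound
  rw [tendsto_iff_norm_sub_tendsto_zero]
  refine tendsto_of_tendsto_of_tendsto_of_le_of_le' tendsto_const_nhds hbound
    (Eventually.of_forall fun n => norm_nonneg _) ?_
  filter_upwards [hA₀, hA₁, hBε, eventually_ge_atTop 1] with n hwn hhn hεn hn
  have hn0 : (0 : ℝ) < n := by exact_mod_cast hn
  -- Balancedness survives larger block bounds and smaller ε, so the parameters become explicit
  -- powers of n. The height bound is rounded up because it is used as a natural exponent.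
  have hbal := (hM n).mono (w' := A * (n : ℝ) ^ α₁) (h' := (⌈A' * (n : ℝ) ^ α₂⌉₊ : ℕ))
    (hwn.trans (by gcongr; exact le_max_left _ _))
    (hhn.trans (le_trans (by gcongr; exact le_max_left _ _) (Nat.le_ceil _))) hεn
  have hmain := abs_integral_numSur_sub_le (k := ⌈1 * (n : ℝ) ^ κ⌉₊) (hM_meas n) hbal he hexp hc0 hc
    (by positivity) (by positivity) (Nat.ceil_pos.2 (by positivity))
  rw [Real.norm_eq_abs]
  refine hmain.trans (le_of_eq ?_)
  simp only [Function.comp_apply, mul_assoc]
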